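/- Let $K$ be a field, let $Q$ be a finite quiver with $n\ge 2$ vertices, let $J$ be the ideal of the path algebra $KQ$ generated by the arrows, and let $A\cong KQ/J^2$ be the associated radical square zero algebra. For a finitely generated right $A$-module $M$ let $\Omega(M)$ be the kernel of a projective cover of $M$ and $\Omega^{-1}(M)$ the cokernel of an injective envelope of $M$. Let $K_0$ be the abelian group generated by the symbols $[M]$, one for each isomorphism class of finitely generated right $A$-modules, with the relations $[M]=[M']+[M'']$ if $M\cong M'\oplus M''$ and $[P]=0$ if $P$ is projective, and let $\overline\Omega\colon K_0\to K_0$ be the endomorphism $[M]\mapsto[\Omega(M)]$. Let $\langle\mathrm{add}\,M\rangle\subseteq K_0$ be the subgroup generated by the classes of the indecomposable direct summands of $M$, and put $$\phi(M)=\min\{l\in\mathbb N:\ \overline\Omega|_{\overline\Omega^{\,l+s}\langle\mathrm{add}\,M\rangle}\text{ is injective for all } s\ge 0\},\qquad \phi\dim(A)=\sup_M\phi(M).$$ Assume that $Q$ has no member, i.e. that every vertex of $Q$ lies in the heart: for every vertex $v$ the simple module at $v$ is in the support of $\Omega^n(A_0)$ and in the support of $\Omega^{-n}(A_0)$, where $A_0=KQ/J$.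 Assume also that $A$ is not self-injective. Then $$\phi\dim(A)=m+1,$$ where $m$ is the size of the largest Jordan block with eigenvalue $0$ in the Jordan normal form over $\mathbb C$ of the adjacency matrix of $Q$ (and $m=0$ if $0$ is not an eigenvalue). -/

import Mathlib

universe u v w z

noncomputable section

/-! ### Path algebras -/

namespace PathAlg

/-- The set of all paths of a quiver (a path has a source, a target, and any length `≥ 0`). -/
abbrev QPath (V : Type v) [Quiver.{w} V] : Type (max v w) :=
  Σ a b : V, Quiver.Path a b

end PathAlg

/-- The path algebra `K Q`: the `K`-vector space with basis the paths of the quiver. The product of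
two paths `p`, `q` is the path "first `p`, then `q`" if `p` ends where `q` starts, and `0`
otherwise. -/
def PathAlgebra (K : Type z) (V : Type v) [Field K] [Quiver.{w} V] : Type (max z v w) :=
  PathAlg.QPath V →₀ K

namespace PathAlg

variable (K : Type z) (V : Type v) [Field K] [Quiver.{w} V]

instance : AddCommGroup (PathAlgebra K V) := inferInstanceAs (AddCommGroup (QPath V →₀ K))
instance : Module K (PathAlgebra K V) := inferInstanceAs (Module K (QPath V →₀ K))

variable {V}

/-- A path as a basis element of the path algebra. -/
def ofPath {a b : V} (p : Quiver.Path a b) : PathAlgebra K V :=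
  Finsupp.single (⟨a, b, p⟩ : QPath V) (1 : K)

open Classical in
/-- The product of two paths: their concatenation, or `0` if they are not composable. -/
def pathMul (p q : QPath V) : PathAlgebra K V :=
  if h : p.2.1 = q.1 then ofPath K (p.2.2.comp (q.2.2.cast h.symm rfl)) else 0

variable (V)

variable {K V} in
/-- The linear extension of a function that is given on the paths. -/
def lift {M : Type*} [AddCommGroup M] [Module K M] (f : QPath V → M) : PathAlgebra K V →ₗ[K] M :=
  (Finsupp.linearCombination K f : (QPath V →₀ K) →ₗ[K] M)

theorem lift_ofPath {M : Type*} [AddCommGroup M] [Module K M] (f : QPath V → M) {a b : V}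
    (p : Quiver.Path a b) : lift f (ofPath K p) = f ⟨a, b, p⟩ :=
  (Finsupp.linearCombination_single K (1 : K) _).trans (one_smul K _)

/-- The bilinear extension of the product of paths. -/
def mulHom : PathAlgebra K V →ₗ[K] PathAlgebra K V →ₗ[K] PathAlgebra K V :=
  lift fun p => lift fun q => pathMul K p q

variable {V}

theorem mulHom_ofPath {a b c d : V} (p : Quiver.Path a b) (q : Quiver.Path c d) :
    mulHom K V (ofPath K p) (ofPath K q) = pathMul K ⟨a, b, p⟩ ⟨c, d, q⟩ := by
  rw [mulHom, lift_ofPath, lift_ofPath]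

theorem mulHom_comp {a b c : V} (p : Quiver.Path a b) (q : Quiver.Path b c) :
    mulHom K V (ofPath K p) (ofPath K q) = ofPath K (p.comp q) := by
  rw [mulHom_ofPath]; simp [pathMul]

theorem mulHom_ne {a b c d : V} (p : Quiver.Path a b) (q : Quiver.Path c d) (h : b ≠ c) :
    mulHom K V (ofPath K p) (ofPath K q) = 0 := by
  rw [mulHom_ofPath]; simp [pathMul, h]

theorem lin_ext {M : Type*} [AddCommGroup M] [Module K M] {f g : PathAlgebra K V →ₗ[K] M}
    (h : ∀ (a b : V) (p : Quiver.Path a b), f (ofPath K p) = g (ofPath K p)) : f = g :=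
  Finsupp.lhom_ext' (R := K) (M := K) (N := M) (α := QPath V)
    (fun ⟨a, b, p⟩ => LinearMap.ext_ring (h a b p))

theorem mulHom_assoc (x y t : PathAlgebra K V) :
    mulHom K V (mulHom K V x y) t = mulHom K V x (mulHom K V y t) := by
  have key : (mulHom K V).compr₂ (mulHom K V) =
      ((LinearMap.llcomp K (PathAlgebra K V) (PathAlgebra K V) (PathAlgebra K V)).flip.comp
        (mulHom K V)).flip.comp (mulHom K V) := by
    refine lin_ext K fun a b p => lin_ext K fun c d q => lin_ext K fun e f r => ?_
    simp only [LinearMap.compr₂_apply, LinearMap.comp_apply, LinearMap.flip_apply,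
      LinearMap.llcomp_apply]
    by_cases h : b = c
    · subst h
      by_cases h' : d = e
      · subst h'
        simp only [mulHom_comp, Quiver.Path.comp_assoc]
      · simp only [mulHom_comp, mulHom_ne K _ _ h', map_zero]
    · by_cases h' : d = e
      · subst h'
        simp only [mulHom_comp, mulHom_ne K _ _ h, map_zero, LinearMap.zero_apply]
      · simp only [mulHom_ne K _ _ h, mulHom_ne K _ _ h', map_zero, LinearMap.zero_apply]
  exact congrArg (fun f => f x y t) key

variable [Fintype V]

variable (V) in
/-- The unit of the path algebra: the sum of all trivial paths. -/
def oneElt : PathAlgebra K V := ∑ v : V, ofPath K (Quiver.Path.nil : Quiver.Path v v)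

theorem oneElt_mul (x : PathAlgebra K V) : mulHom K V (oneElt K V) x = x := by
  have key : mulHom K V (oneElt K V) = LinearMap.id := by
    refine lin_ext K fun a b p => ?_
    rw [oneElt, map_sum, LinearMap.sum_apply, Finset.sum_eq_single a]
    · rw [mulHom_comp, Quiver.Path.nil_comp]; rfl
    · intro c _ hc; exact mulHom_ne K _ _ hc
    · intro h; exact absurd (Finset.mem_univ a) h
  rw [key]; rfl

theorem mul_oneElt (x : PathAlgebra K V) : mulHom K V x (oneElt K V) = x := by
  have key : (mulHom K V).flip (oneElt K V) = LinearMap.id := by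
    refine lin_ext K fun a b p => ?_
    rw [LinearMap.flip_apply, oneElt, map_sum, Finset.sum_eq_single b]
    · rw [mulHom_comp, Quiver.Path.comp_nil]; rfl
    · intro c _ hc; exact mulHom_ne K _ _ hc.symm
    · intro h; exact absurd (Finset.mem_univ b) h
  exact congrArg (fun f => f x) key

instance : Ring (PathAlgebra K V) :=
  { (inferInstance : AddCommGroup (PathAlgebra K V)) with
    mul := fun x y => mulHom K V x y
    one := oneElt K V
    left_distrib := fun x y t => map_add (mulHom K V x) y t
    right_distrib := fun x y t => congrArg (fun f => f t) (map_add (mulHom K V) x y)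
    zero_mul := fun x => congrArg (fun f => f x) (map_zero (mulHom K V))
    mul_zero := fun x => map_zero (mulHom K V x)
    mul_assoc := mulHom_assoc K
    one_mul := oneElt_mul K
    mul_one := mul_oneElt K }

instance : Algebra K (PathAlgebra K V) :=
  Algebra.ofModule
    (fun r x y => congrArg (fun f => f y) (map_smul (mulHom K V) r x))
    (fun r x y => map_smul (mulHom K V x) r y)

variable (V)

/-- The two-sided ideal `J` of the path algebra generated by the arrows. -/
def arrowIdeal : Ideal (PathAlgebra K V) :=
  (TwoSidedIdeal.span {x : PathAlgebra K V |
    ∃ (a b : V) (α : a ⟶ b), x = ofPath K α.toPath}).asIdeal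

instance : (arrowIdeal K V).IsTwoSided :=
  inferInstanceAs (TwoSidedIdeal.asIdeal _).IsTwoSided

end PathAlg

/-- The algebra `K Q / J²`, where `J` is the ideal of `K Q` generated by the arrows. -/
abbrev RadSqZero (K : Type z) (V : Type v) [Field K] [Quiver.{w} V] [Fintype V] :
    Type (max z v w) :=
  PathAlgebra K V ⧸ (PathAlg.arrowIdeal K V ^ 2)

/-! ### Syzygies, cosyzygies and the Igusa–Todorov function

The notions of this part are for left modules over a ring `R`; right modules over an algebra `A`
are obtained for `R = Aᵐᵒᵖ`. -/

namespace IgusaTodorov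

section Relations

variable {R : Type u} [Ring R]

/-- A submodule `N` of `M` is superfluous if `X + N = M` only for `X = M`. -/
def IsSuperfluous {M : Type*} [AddCommGroup M] [Module R M] (N : Submodule R M) : Prop :=
  ∀ X : Submodule R M, X ⊔ N = ⊤ → X = ⊤

/-- A submodule `N` of `M` is essential if `X ∩ N = 0` only for `X = 0`. -/
def IsEssential {M : Type*} [AddCommGroup M] [Module R M] (N : Submodule R M) : Prop :=
  ∀ X : Submodule R M, X ⊓ N = ⊥ → X = ⊥

/-- `f : P → M` is a projective cover. -/
def IsProjectiveCover {P M : Type u} [AddCommGroup P] [Module R P] [AddCommGroup M] [Module R M]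
    (f : P →ₗ[R] M) : Prop :=
  Module.Projective R P ∧ Function.Surjective f ∧ IsSuperfluous (LinearMap.ker f)

/-- `f : M → I` is an injective envelope. -/
def IsInjectiveEnvelope {M I : Type u} [AddCommGroup M] [Module R M] [AddCommGroup I] [Module R I]
    (f : M →ₗ[R] I) : Prop :=
  Module.Injective R I ∧ Function.Injective f ∧ IsEssential (LinearMap.range f)

/-- `N ≅ Ω(M)`: `N` is isomorphic to the kernel of a projective cover of `M`. -/
def IsSyzygy (M N : FGModuleCat.{u} R) : Prop :=
  ∃ (P : FGModuleCat.{u} R) (f : P →ₗ[R] M),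
    IsProjectiveCover f ∧ Nonempty (N ≃ₗ[R] LinearMap.ker f)

/-- `N ≅ Ω⁻¹(M)`: `N` is isomorphic to the cokernel of an injective envelope of `M`. -/
def IsCosyzygy (M N : FGModuleCat.{u} R) : Prop :=
  ∃ (I : FGModuleCat.{u} R) (f : M →ₗ[R] I),
    IsInjectiveEnvelope f ∧ Nonempty (N ≃ₗ[R] (I ⧸ LinearMap.range f))

/-- `N ≅ Ωᵏ(M)`. -/
def IsIterSyzygy : ℕ → FGModuleCat.{u} R → FGModuleCat.{u} R → Prop
  | 0, M, N => Nonempty (N ≃ₗ[R] M)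
  | k + 1, M, N => ∃ L, IsIterSyzygy k M L ∧ IsSyzygy L N

/-- `N ≅ Ω⁻ᵏ(M)`. -/
def IsIterCosyzygy : ℕ → FGModuleCat.{u} R → FGModuleCat.{u} R → Prop
  | 0, M, N => Nonempty (N ≃ₗ[R] M)
  | k + 1, M, N => ∃ L, IsIterCosyzygy k M L ∧ IsCosyzygy L N

end Relations

section K0

variable (R : Type u) [Ring R]

/-- The relations `[M] - [M'] - [M'']` for `M ≅ M' ⊕ M''`, and `[P]` for `P` projective. -/
def relations : Set (FreeAbelianGroup (FGModuleCat.{u} R)) :=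
  {x | ∃ M M' M'' : FGModuleCat.{u} R, Nonempty (M ≃ₗ[R] (M' × M'')) ∧
      x = FreeAbelianGroup.of M - FreeAbelianGroup.of M' - FreeAbelianGroup.of M''} ∪
  {x | ∃ P : FGModuleCat.{u} R, Module.Projective R P ∧ x = FreeAbelianGroup.of P}

/-- The group `K₀`, generated by symbols `[M]` for the finitely generated modules, with the above
relations. (Isomorphic modules have the same class because of the first relation with `M'' = 0`,
see `cls_congr`.) -/
abbrev K0 : Type (u + 1) :=
  FreeAbelianGroup (FGModuleCat.{u} R) ⧸ AddSubgroup.closure (relations R)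

variable {R}

/-- The class `[M]` in `K₀`. -/
def cls (M : FGModuleCat.{u} R) : K0 R := QuotientAddGroup.mk (FreeAbelianGroup.of M)

theorem cls_prod {M M' M'' : FGModuleCat.{u} R} (e : M ≃ₗ[R] (M' × M'')) :
    cls M = cls M' + cls M'' := by
  have h : (QuotientAddGroup.mk (FreeAbelianGroup.of M - FreeAbelianGroup.of M' -
      FreeAbelianGroup.of M'') : K0 R) = 0 :=
    (QuotientAddGroup.eq_zero_iff _).2
      (AddSubgroup.subset_closure (Or.inl ⟨M, M', M'', ⟨e⟩, rfl⟩))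
  have h' : cls M - cls M' - cls M'' = 0 := h
  rw [sub_sub, sub_eq_zero] at h'
  exact h'

theorem cls_projective (P : FGModuleCat.{u} R) (hP : Module.Projective R P) : cls P = 0 :=
  (QuotientAddGroup.eq_zero_iff _).2 (AddSubgroup.subset_closure (Or.inr ⟨P, hP, rfl⟩))

theorem cls_congr {M N : FGModuleCat.{u} R} (e : M ≃ₗ[R] N) : cls M = cls N := by
  have h := cls_prod (M := M) (M' := N) (M'' := FGModuleCat.of R PUnit.{u + 1})
    (e.trans (LinearEquiv.prodUnique (R := R) (M := N) (M₂ := PUnit.{u + 1})).symm)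
  rw [h, cls_projective (FGModuleCat.of R PUnit.{u + 1})
    (inferInstanceAs (Module.Projective R PUnit.{u + 1})), add_zero]

/-- Schanuel's lemma. -/
theorem schanuel {P P' M M' : Type u} [AddCommGroup P] [Module R P] [AddCommGroup P'] [Module R P']
    [AddCommGroup M] [Module R M] [AddCommGroup M'] [Module R M']
    [Module.Projective R P] [Module.Projective R P']
    (f : P →ₗ[R] M) (f' : P' →ₗ[R] M') (hf : Function.Surjective f)
    (hf' : Function.Surjective f') (e : M ≃ₗ[R] M') :
    Nonempty ((LinearMap.ker f × P') ≃ₗ[R] (LinearMap.ker f' × P)) := by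
  obtain ⟨s, hs⟩ := Module.projective_lifting_property f' (e.toLinearMap ∘ₗ f) hf'
  obtain ⟨t, ht⟩ := Module.projective_lifting_property f (e.symm.toLinearMap ∘ₗ f') hf
  have hs' : ∀ x, f' (s x) = e (f x) := fun x => congrArg (fun g => g x) hs
  have ht' : ∀ x, f (t x) = e.symm (f' x) := fun x => congrArg (fun g => g x) ht
  refine ⟨LinearEquiv.ofLinearMap
    (LinearMap.prod
      (LinearMap.codRestrict _
        (LinearMap.snd R _ _ - s ∘ₗ ((Submodule.subtype _).coprod t)) ?_)
      ((Submodule.subtype _).coprod t))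
    (LinearMap.prod
      (LinearMap.codRestrict _
        (LinearMap.snd R _ _ - t ∘ₗ ((Submodule.subtype _).coprod s)) ?_)
      ((Submodule.subtype _).coprod s)) ?_ ?_⟩
  · rintro ⟨⟨x, hx⟩, y⟩
    simp only [LinearMap.mem_ker] at hx
    simp [hs', ht', hx]
  · rintro ⟨⟨x, hx⟩, y⟩
    simp only [LinearMap.mem_ker] at hx
    simp [hs', ht', hx]
  · ext x <;> simp
  · ext x <;> simp

end K0

section Syzygy

variable {R : Type u} [Ring R] [IsArtinianRing R]

/-- Over an artinian ring every finitely generated module has a projective cover. -/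
theorem exists_isSyzygy (M : FGModuleCat.{u} R) : ∃ N, IsSyzygy M N := by
  obtain ⟨n, f, hf⟩ := Module.Finite.exists_fin' R M
  let S : Set (Submodule R (Fin n → R)) := {X | Module.Projective R X ∧ X.map f = ⊤}
  have hS : S.Nonempty := by
    refine ⟨⊤, ?_, ?_⟩
    · exact Module.Projective.of_equiv (Submodule.topEquiv (R := R) (M := Fin n → R)).symm
    · rw [Submodule.map_top, LinearMap.range_eq_top.2 hf]
  obtain ⟨X, ⟨hXp, hXm⟩, hmin⟩ := WellFounded.has_min
    (wellFounded_lt (α := Submodule R (Fin n → R))) S hS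
  let g : X →ₗ[R] M := f ∘ₗ X.subtype
  have hg : Function.Surjective g := by
    intro m
    have hm : m ∈ X.map f := hXm ▸ Submodule.mem_top
    obtain ⟨x, hx, rfl⟩ := hm
    exact ⟨⟨x, hx⟩, rfl⟩
  have hcover : IsSuperfluous (LinearMap.ker g) := by
    intro Y hY
    have hgY : Function.Surjective (g ∘ₗ Y.subtype) := by
      intro m
      obtain ⟨x, rfl⟩ := hg m
      have hx : x ∈ Y ⊔ LinearMap.ker g := hY ▸ Submodule.mem_top
      obtain ⟨y, hy, z, hz, rfl⟩ := Submodule.mem_sup.1 hx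
      refine ⟨⟨y, hy⟩, ?_⟩
      simp [LinearMap.mem_ker.1 hz]
    obtain ⟨h, hh⟩ := Module.projective_lifting_property (g ∘ₗ Y.subtype) g hgY
    let k : Module.End R X := Y.subtype ∘ₗ h
    have hk : ∀ x, g (k x) = g x := fun x => congrArg (fun l => l x) hh
    have hkn : ∀ j : ℕ, ∀ x, g ((k ^ j) x) = g x := by
      intro j
      induction j with
      | zero => intro x; rfl
      | succ j ih => intro x; rw [pow_succ', Module.End.mul_apply, hk, ih]
    obtain ⟨j, hj, hj1⟩ := ((LinearMap.eventually_isCompl_ker_pow_range_pow k).and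
      (Filter.eventually_ge_atTop 1)).exists
    have hproj : Module.Projective R (LinearMap.range (k ^ j)) :=
      Module.Projective.of_split (LinearMap.range (k ^ j)).subtype
        (Submodule.projectionOnto _ _ hj.symm)
        (by ext x; simp)
    have hmem : (LinearMap.range (k ^ j)).map X.subtype ∈ S := by
      refine ⟨?_, ?_⟩
      · exact Module.Projective.of_equiv
          (Submodule.equivMapOfInjective X.subtype X.subtype_injective _)
      · refine eq_top_iff.2 fun m _ => ?_
        obtain ⟨x, rfl⟩ := hg m
        exact ⟨_, ⟨_, ⟨x, rfl⟩, rfl⟩, hkn j x⟩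
    have hle : (LinearMap.range (k ^ j)).map X.subtype ≤ X := by
      rintro _ ⟨x, -, rfl⟩
      exact x.2
    have heq : (LinearMap.range (k ^ j)).map X.subtype = X :=
      hle.eq_of_not_lt (hmin _ hmem)
    refine eq_top_iff.2 fun x _ => ?_
    have hx : (x : Fin n → R) ∈ (LinearMap.range (k ^ j)).map X.subtype := heq.symm ▸ x.2
    obtain ⟨_, ⟨x', rfl⟩, hx'⟩ := hx
    obtain ⟨i, rfl⟩ : ∃ i, j = i + 1 := ⟨j - 1, by omega⟩
    have : x = k ((k ^ i) x') := by
      rw [← Module.End.mul_apply, ← pow_succ']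
      exact (Subtype.ext hx').symm
    rw [this]
    exact (h _).2
  exact ⟨FGModuleCat.of R (LinearMap.ker g), FGModuleCat.of R X, g, ⟨hXp, hg, hcover⟩,
    ⟨LinearEquiv.refl _ _⟩⟩

/-- The syzygy `Ω(M)`: the kernel of a projective cover of `M`. -/
def syzygy (M : FGModuleCat.{u} R) : FGModuleCat.{u} R := (exists_isSyzygy M).choose

theorem isSyzygy_syzygy (M : FGModuleCat.{u} R) : IsSyzygy M (syzygy M) :=
  (exists_isSyzygy M).choose_spec

/-- `[Ω(M)]` is the class of the kernel of any surjection from a projective module onto `M`. -/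
theorem cls_syzygy_eq {M P N : FGModuleCat.{u} R} [Module.Projective R P] (f : P →ₗ[R] M)
    (hf : Function.Surjective f) (e : N ≃ₗ[R] LinearMap.ker f) : cls (syzygy M) = cls N := by
  obtain ⟨P', f', ⟨hP', hf', -⟩, ⟨e'⟩⟩ := isSyzygy_syzygy M
  obtain ⟨s⟩ := schanuel f' f hf' hf (LinearEquiv.refl R M)
  let X := FGModuleCat.of R (syzygy M × P)
  have h1 : cls X = cls (syzygy M) + cls P := cls_prod (LinearEquiv.refl R _)
  have h2 : cls X = cls N + cls P' :=
    cls_prod (((e'.prodCongr (LinearEquiv.refl R P)).trans s).trans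
      (e.symm.prodCongr (LinearEquiv.refl R P')))
  rw [cls_projective P inferInstance, add_zero] at h1
  rw [cls_projective P' hP', add_zero] at h2
  rw [← h1, h2]

theorem cls_syzygy_prod {M M' M'' : FGModuleCat.{u} R} (e : M ≃ₗ[R] (M' × M'')) :
    cls (syzygy M) = cls (syzygy M') + cls (syzygy M'') := by
  obtain ⟨P', f', ⟨hP', hf', -⟩, ⟨e'⟩⟩ := isSyzygy_syzygy M'
  obtain ⟨P'', f'', ⟨hP'', hf'', -⟩, ⟨e''⟩⟩ := isSyzygy_syzygy M''
  let F : (P' × P'') →ₗ[R] M := e.symm.toLinearMap ∘ₗ f'.prodMap f''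
  have hF : Function.Surjective F := e.symm.surjective.comp (hf'.prodMap hf'')
  have hk : LinearMap.ker F = (LinearMap.ker f').prod (LinearMap.ker f'') := by
    rw [← LinearMap.ker_prodMap]
    exact LinearEquiv.ker_comp _ _
  have hk' : ∀ x, x ∈ LinearMap.ker F ↔ x.1 ∈ LinearMap.ker f' ∧ x.2 ∈ LinearMap.ker f'' :=
    fun x => by rw [hk, Submodule.mem_prod]
  let N := FGModuleCat.of R (syzygy M' × syzygy M'')
  let E : (LinearMap.ker f' × LinearMap.ker f'') ≃ₗ[R] LinearMap.ker F :=
    { toFun := fun x => ⟨(x.1, x.2), (hk' _).2 ⟨x.1.2, x.2.2⟩⟩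
      map_add' := fun _ _ => rfl
      map_smul' := fun _ _ => rfl
      invFun := fun x => (⟨x.1.1, ((hk' _).1 x.2).1⟩,
        ⟨x.1.2, ((hk' _).1 x.2).2⟩)
      left_inv := fun _ => rfl
      right_inv := fun _ => rfl }
  have hN : cls (syzygy M) = cls N :=
    cls_syzygy_eq (P := FGModuleCat.of R (P' × P'')) F hF
      ((e'.prodCongr e'').trans E)
  rw [hN]
  exact cls_prod (LinearEquiv.refl R _)

theorem cls_syzygy_projective (P : FGModuleCat.{u} R) (hP : Module.Projective R P) :
    cls (syzygy P) = 0 := by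
  rw [cls_syzygy_eq (P := P) (N := FGModuleCat.of R PUnit.{u + 1}) LinearMap.id
    Function.surjective_id ((LinearEquiv.ofEq _ _ LinearMap.ker_id).trans
      (Submodule.botEquivPUnit.{u, u, u})).symm]
  exact cls_projective _ (inferInstanceAs (Module.Projective R PUnit.{u + 1}))

variable (R) in
/-- The endomorphism `[M] ↦ [Ω(M)]` of `K₀`. -/
def syzygyMap : K0 R →+ K0 R :=
  QuotientAddGroup.lift _ (FreeAbelianGroup.lift fun M => cls (syzygy M)) <| by
    rw [AddSubgroup.closure_le]
    rintro x (⟨M, M', M'', ⟨e⟩, rfl⟩ | ⟨P, hP, rfl⟩)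
    · simp [AddMonoidHom.mem_ker, cls_syzygy_prod e]
    · simp [AddMonoidHom.mem_ker, cls_syzygy_projective P hP]

theorem syzygyMap_cls (M : FGModuleCat.{u} R) : syzygyMap R (cls M) = cls (syzygy M) := by
  simp [syzygyMap, cls]

/-- An indecomposable module: nonzero, and not the direct sum of two nonzero modules. -/
def IsIndecomposable (M : FGModuleCat.{u} R) : Prop :=
  Nontrivial M ∧ ∀ X Y : FGModuleCat.{u} R, Nonempty (M ≃ₗ[R] (X × Y)) →
    Subsingleton X ∨ Subsingleton Y

/-- `⟨add M⟩`: the subgroup of `K₀` generated by the classes of the indecomposable direct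
summands of `M`. -/
def addSpan (M : FGModuleCat.{u} R) : AddSubgroup (K0 R) :=
  AddSubgroup.closure {x | ∃ N N' : FGModuleCat.{u} R,
    IsIndecomposable N ∧ Nonempty (M ≃ₗ[R] (N × N')) ∧ x = cls N}

/-- The Igusa–Todorov function: `φ(M)` is the least `l` such that `Ω̄` is injective on
`Ω̄^(l+s) ⟨add M⟩` for all `s ≥ 0`. (It would be `⊤` if there were no such `l`.) -/
def phi (M : FGModuleCat.{u} R) : ℕ∞ :=
  ⨅ l ∈ {l : ℕ | ∀ s : ℕ, Set.InjOn (syzygyMap R)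
    ((syzygyMap R)^[l + s] '' (addSpan M : Set (K0 R)))}, (l : ℕ∞)

variable (R) in
/-- The `φ`-dimension of `R`: the supremum of `φ(M)` over the finitely generated `R`-modules. -/
def phiDim : ℕ∞ := ⨆ M : FGModuleCat.{u} R, phi M

end Syzygy

end IgusaTodorov

/-! ### Heart and member of a quiver -/

namespace QuiverHeart

open IgusaTodorov MulOpposite

variable (K : Type z) {V : Type v} [Field K] [Quiver.{w} V] [Fintype V]

/-- The idempotent of `K Q / J²` given by the trivial path at `v`. -/
def vertexIdem (v : V) : RadSqZero K V :=
  Ideal.Quotient.mk (PathAlg.arrowIdeal K V ^ 2)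
    (PathAlg.ofPath K (Quiver.Path.nil : Quiver.Path v v))

variable (V) in
/-- The right ideal `J / J²` of `K Q / J²`. -/
def radical : Submodule (RadSqZero K V)ᵐᵒᵖ (RadSqZero K V) :=
  Submodule.span _ (Ideal.Quotient.mk (PathAlg.arrowIdeal K V ^ 2) ''
    (PathAlg.arrowIdeal K V : Set (PathAlgebra K V)))

instance : Module.Finite (RadSqZero K V)ᵐᵒᵖ (RadSqZero K V) :=
  Module.Finite.of_surjective
    (LinearMap.toSpanSingleton (RadSqZero K V)ᵐᵒᵖ (RadSqZero K V) 1) fun x =>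
    ⟨op x, by simp⟩

variable (V) in
/-- The right module `A₀ = K Q / J` over `K Q / J²`, the direct sum of all simple modules. -/
def semisimpleTop : FGModuleCat (RadSqZero K V)ᵐᵒᵖ :=
  FGModuleCat.of _ (RadSqZero K V ⧸ radical K V)

/-- The vertex `v` is in the support of the right module `M`: `M e_v ≠ 0`, that is, the simple
module at `v` is a composition factor of `M`. -/
def InSupport (v : V) (M : FGModuleCat (RadSqZero K V)ᵐᵒᵖ) : Prop :=
  ∃ x : M, op (vertexIdem K v) • x ≠ 0

/-- The vertex `v` lies in the heart of the quiver: it is in the supports of `Ωⁿ(A₀)` and of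
`Ω⁻ⁿ(A₀)`, where `n` is the number of vertices. -/
def InHeart (v : V) : Prop :=
  (∃ N, IsIterSyzygy (Fintype.card V) (semisimpleTop K V) N ∧ InSupport K v N) ∧
  (∃ N, IsIterCosyzygy (Fintype.card V) (semisimpleTop K V) N ∧ InSupport K v N)

variable (V) in
/-- The quiver has no member: every vertex lies in the heart. -/
def NoMember : Prop := ∀ v : V, InHeart K v

end QuiverHeart

/-! ### Adjacency matrix and Jordan forms -/

/-- The adjacency matrix of a quiver, with complex entries: the entry `(a, b)` is the number of
arrows from `a` to `b`. -/
def adjacencyMatrix (V : Type v) [Quiver.{w} V] [∀ a b : V, Fintype (a ⟶ b)] : Matrix V V ℂ :=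
  Matrix.of fun a b => (Fintype.card (a ⟶ b) : ℂ)

/-- The Jordan block of size `k` with eigenvalue `a` (ones below the diagonal). -/
def jordanBlock (k : ℕ) (a : ℂ) : Matrix (Fin k) (Fin k) ℂ :=
  Matrix.of fun i j => if i = j then a else if (i : ℕ) = j + 1 then 1 else 0

/-- The matrix `M` is similar to the block diagonal matrix with Jordan blocks of the (positive)
sizes `size i` and with eigenvalues `eig i`, `i = 1, …, r`. -/
def IsJordanForm {V : Type v} [Fintype V] [DecidableEq V] (M : Matrix V V ℂ) {r : ℕ}
    (size : Fin r → ℕ) (eig : Fin r → ℂ) : Prop :=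
  (∀ i, 0 < size i) ∧
  ∃ (σ : (Σ i, Fin (size i)) ≃ V) (P : Matrix V V ℂ), IsUnit P ∧
    P * M = Matrix.reindex σ σ (Matrix.blockDiagonal' fun i => jordanBlock (size i) (eig i)) * P

open Classical in
/-- The largest size of a Jordan block with eigenvalue `a`, and `0` if there is no such block. -/
def maxBlockSize {r : ℕ} (size : Fin r → ℕ) (eig : Fin r → ℂ) (a : ℂ) : ℕ :=
  Finset.univ.sup fun i => if eig i = a then size i else 0

end

set_option linter.unusedSectionVars false

noncomputable section

/-! ### Algebras with the multiplication table of a radical square zero algebra -/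

/-! Right `A`-modules are left modules over `R = Aᵐᵒᵖ`, which has a basis of vertices and arrows. A
superfluous submodule lies in the radical, and arrows kill the radical because `J² = 0`. So syzygies
are semisimple, and one application of `Ω̄` carries `K₀` into the subgroup spanned by the classes of
the simple modules (`syzygyMap_mem_range`).

The absence of members enters through two facts: every vertex is the source of an arrow and the
target of an arrow. Outgoing arrows make the socle of a projective module lie in its radical. Hence
"length of the socle at `v` minus length of the radical at `v`" descends to `K₀` (`multHom`) and
shows that the simple classes are independent. Their span is therefore `ℤ^V`, on which `Ω̄` is
multiplication of row vectors by the arrow matrix `M` (`syzygyMap_semisimpleCls`). Incoming arrows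
make every simple class a value of `Ω̄` (`exists_syzygyMap_eq`).

The `φ`-dimension is the point from which the kernels of `Ω̄ⁿ` on `K₀` stop growing (`phiDim_le`,
`le_phiDim`). The kernels of `Mⁿ` stop growing at `n = m`, and the first step into `ℤ^V` costs at
most one more, which gives `m + 1` as an upper bound. If `m > 0`, a vector killed by `M^m` but not
by `M^(m-1)` lifts along `Ω̄`, so the bound is attained. If `m = 0`, a nonzero element of `ker Ω̄`
is needed. Since `A` is not self-injective, two arrows `α`, `β` share a source, and the projective
module there modulo `α` has a simple syzygy but zero image under `multHom`. As `M` is invertible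
over `ℚ`, a multiple of its class differs from a semisimple class by an element of the kernel
(`exists_syzygyMap_eq_zero`).

Jordan forms identify `m` over `ℂ`; `exists_int_vecMul` brings the required vector down to `ℤ`. -/

/-- The basis `b` of `R` consists of orthogonal idempotents `b (inl v)` with sum `1` and of arrows
`b (inr α)` from `s α` to `t α`, composed like functions, whose pairwise products vanish. -/
structure IsRadSqZeroBasis {K : Type z} [Field K] {R : Type u} [Ring R] [Algebra K R]
    {V : Type v} {E : Type w} [Fintype V] (b : Module.Basis (V ⊕ E) K R) (s t : E → V) :
    Prop where
  vertex_mul_self : ∀ v, b (.inl v) * b (.inl v) = b (.inl v)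
  vertex_mul_vertex : ∀ u v, u ≠ v → b (.inl u) * b (.inl v) = 0
  arrow_mul_source : ∀ α, b (.inr α) * b (.inl (s α)) = b (.inr α)
  target_mul_arrow : ∀ α, b (.inl (t α)) * b (.inr α) = b (.inr α)
  arrow_mul_arrow : ∀ α β, b (.inr α) * b (.inr β) = 0
  sum_vertex : ∑ v, b (.inl v) = 1

namespace IsRadSqZeroBasis

variable {K : Type z} [Field K] {R : Type u} [Ring R] [Algebra K R] {V : Type v} {E : Type w}
  [Fintype V] {b : Module.Basis (V ⊕ E) K R} {s t : E → V}

theorem vertex_mul_arrow (hb : IsRadSqZeroBasis b s t) {v : V} {α : E} (h : v ≠ t α) :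
    b (.inl v) * b (.inr α) = 0 := by
  rw [← hb.target_mul_arrow, ← mul_assoc, hb.vertex_mul_vertex _ _ h, zero_mul]

theorem arrow_mul_vertex (hb : IsRadSqZeroBasis b s t) {v : V} {α : E} (h : s α ≠ v) :
    b (.inr α) * b (.inl v) = 0 := by
  rw [← hb.arrow_mul_source, mul_assoc, hb.vertex_mul_vertex _ _ h, mul_zero]

variable {M : Type*} [AddCommGroup M] [Module R M]
  {N : Type*} [AddCommGroup N] [Module R N]

theorem sum_vertex_smul (hb : IsRadSqZeroBasis b s t) (m : M) : ∑ v, b (.inl v) • m = m := by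
  rw [← Finset.sum_smul, hb.sum_vertex, one_smul]

variable (M) in
/-- The component at the vertex `v` of the radical. -/
def rad (_ : IsRadSqZeroBasis b s t) (v : V) : Submodule R M :=
  Submodule.span R {m | ∃ α n, t α = v ∧ m = b (.inr α) • n}

theorem map_mem_rad (hb : IsRadSqZeroBasis b s t) (f : M →ₗ[R] N) {v : V} {m : M}
    (h : m ∈ hb.rad M v) : f m ∈ hb.rad N v := by
  have : hb.rad M v ≤ (hb.rad N v).comap f := by
    rw [rad, Submodule.span_le]
    rintro _ ⟨α, n, rfl, rfl⟩
    exact Submodule.subset_span ⟨α, f n, rfl, map_smul f _ _⟩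
  exact this h

/-! ### Coefficients of products; socle and radical at a vertex. -/

variable [Fintype E]

theorem expand (b : Module.Basis (V ⊕ E) K R) (r : R) :
    r = ∑ v, b.repr r (.inl v) • b (.inl v) + ∑ α, b.repr r (.inr α) • b (.inr α) := by
  conv_lhs => rw [← b.sum_repr r, Fintype.sum_sum_type]

theorem arrow_mul (hb : IsRadSqZeroBasis b s t) (α : E) (r : R) :
    b (.inr α) * r = b.repr r (.inl (s α)) • b (.inr α) := by
  conv_lhs => rw [expand b r]
  rw [mul_add, Finset.mul_sum, Finset.mul_sum, Finset.sum_eq_single (s α)]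
  · simp [hb.arrow_mul_source, hb.arrow_mul_arrow]
  · intro v _ hv
    rw [mul_smul_comm, hb.arrow_mul_vertex hv.symm, smul_zero]
  · simp

theorem vertex_mul (hb : IsRadSqZeroBasis b s t) [DecidableEq V] (v : V) (r : R) :
    b (.inl v) * r = b.repr r (.inl v) • b (.inl v) +
      ∑ α with t α = v, b.repr r (.inr α) • b (.inr α) := by
  conv_lhs => rw [expand b r]
  rw [mul_add, Finset.mul_sum, Finset.mul_sum, Finset.sum_eq_single v, Finset.sum_filter]
  · congr 1
    · rw [mul_smul_comm, hb.vertex_mul_self]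
    · refine Finset.sum_congr rfl fun α _ => ?_
      split_ifs with h
      · rw [mul_smul_comm, ← h, hb.target_mul_arrow]
      · rw [mul_smul_comm, hb.vertex_mul_arrow (Ne.symm h), smul_zero]
  · intro u _ hu
    rw [mul_smul_comm, hb.vertex_mul_vertex _ _ hu.symm, smul_zero]
  · simp

theorem repr_mul_vertex (hb : IsRadSqZeroBasis b s t) [DecidableEq V] (u v : V) (r : R) :
    b.repr (r * b (.inl v)) (.inl u) = if u = v then b.repr r (.inl u) else 0 := by
  classical
  conv_lhs => rw [expand b r]
  have h1 : ∀ w, b.repr r (.inl w) • b (.inl w) * b (.inl v) =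
      if w = v then b.repr r (.inl w) • b (.inl w) else 0 := by
    intro w
    split_ifs with h
    · rw [smul_mul_assoc, h, hb.vertex_mul_self]
    · rw [smul_mul_assoc, hb.vertex_mul_vertex _ _ h, smul_zero]
  have h2 : ∀ α, b.repr r (.inr α) • b (.inr α) * b (.inl v) =
      if s α = v then b.repr r (.inr α) • b (.inr α) else 0 := by
    intro α
    split_ifs with h
    · rw [smul_mul_assoc, ← h, hb.arrow_mul_source]
    · rw [smul_mul_assoc, hb.arrow_mul_vertex h, smul_zero]
  rw [add_mul, Finset.sum_mul, Finset.sum_mul, map_add, map_sum, map_sum]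
  simp only [h1, h2, Finsupp.add_apply, Finsupp.finsetSum_apply]
  rw [Finset.sum_eq_single v, Finset.sum_eq_zero, add_zero]
  · by_cases h : u = v
    · simp [h]
    · simp [h]
  · intro α _
    split_ifs <;> simp
  · intro w _ hw
    simp [hw]
  · simp

theorem expand_smul (b : Module.Basis (V ⊕ E) K R) (r : R) (m : M) :
    r • m = ∑ v, algebraMap K R (b.repr r (.inl v)) • b (.inl v) • m +
      ∑ α, algebraMap K R (b.repr r (.inr α)) • b (.inr α) • m := by
  conv_lhs => rw [expand b r]
  simp only [add_smul, Finset.sum_smul, Algebra.smul_def, mul_smul]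

/-- A ring element acts by a scalar on the socle at a vertex. -/
theorem smul_eq_of_socle (hb : IsRadSqZeroBasis b s t) {v : V} {m : M}
    (hv : b (.inl v) • m = m) (hx : ∀ α, b (.inr α) • m = 0) (r : R) :
    r • m = algebraMap K R (b.repr r (.inl v)) • m := by
  rw [expand_smul b r m, Finset.sum_eq_single v]
  · simp [hx, hv]
  · intro u _ hu
    rw [← hv, smul_smul (b (.inl u)), hb.vertex_mul_vertex _ _ hu, zero_smul, smul_zero]
  · simp

variable (M) in
/-- The component at the vertex `v` of the socle. -/
def socle (hb : IsRadSqZeroBasis b s t) (v : V) : Submodule R M where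
  carrier := {m | b (.inl v) • m = m ∧ ∀ α, b (.inr α) • m = 0}
  zero_mem' := by simp
  add_mem' := by
    rintro m n ⟨h1, h2⟩ ⟨h3, h4⟩
    exact ⟨by rw [smul_add, h1, h3], fun α => by rw [smul_add, h2, h4, add_zero]⟩
  smul_mem' := by
    rintro r m ⟨h1, h2⟩
    rw [hb.smul_eq_of_socle h1 h2 r]
    refine ⟨?_, fun α => ?_⟩
    · rw [smul_smul, ← Algebra.commutes, mul_smul, h1]
    · rw [smul_smul, ← Algebra.commutes, mul_smul, h2, smul_zero]

theorem rad_le_socle (hb : IsRadSqZeroBasis b s t) (v : V) : hb.rad M v ≤ hb.socle M v := by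
  rw [rad, Submodule.span_le]
  rintro _ ⟨α, n, rfl, rfl⟩
  refine ⟨?_, fun β => ?_⟩
  · rw [smul_smul, hb.target_mul_arrow]
  · rw [smul_smul, hb.arrow_mul_arrow, zero_smul]

theorem map_mem_socle (hb : IsRadSqZeroBasis b s t) (f : M →ₗ[R] N) {v : V} {m : M}
    (h : m ∈ hb.socle M v) : f m ∈ hb.socle N v := by
  refine ⟨?_, fun α => ?_⟩
  · rw [← map_smul, h.1]
  · rw [← map_smul, h.2, map_zero]

theorem vertex_smul_mem_rad (hb : IsRadSqZeroBasis b s t) {r : R}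
    (hr : ∀ u, b.repr r (.inl u) = 0) (v : V) (m : M) :
    b (.inl v) • r • m ∈ hb.rad M v := by
  classical
  rw [smul_smul, hb.vertex_mul, hr, zero_smul, zero_add, Finset.sum_smul]
  refine Submodule.sum_mem _ fun α hα => ?_
  rw [Algebra.smul_def, mul_smul]
  exact Submodule.smul_mem _ _ (Submodule.subset_span ⟨α, m, (Finset.mem_filter.1 hα).2, rfl⟩)

/-! ### Projective modules -/

/-- Left multiplication by `α` reads off the coefficient at `s α`. With an arrow out of every
vertex, an element killed by all arrows has no vertex part. At a vertex without outgoing arrows the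
idempotent itself would be a counterexample. -/
theorem socle_le_rad_self (hb : IsRadSqZeroBasis b s t) (hs : Function.Surjective s) (v : V) :
    hb.socle R v ≤ hb.rad R v := by
  rintro r ⟨h1, h2⟩
  have hr : ∀ u, b.repr r (.inl u) = 0 := by
    intro u
    obtain ⟨α, rfl⟩ := hs u
    have := h2 α
    rw [smul_eq_mul, hb.arrow_mul] at this
    exact (smul_eq_zero.1 this).resolve_right (b.ne_zero _)
  have := hb.vertex_smul_mem_rad hr v (1 : R)
  rwa [smul_eq_mul r, mul_one, h1] at this

/-- Socle and radical are preserved by homomorphisms, so the inclusion passes from `R` to a free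
module and then to its direct summand `M`. -/
theorem socle_le_rad_of_projective (hb : IsRadSqZeroBasis b s t) (hs : Function.Surjective s)
    [Module.Projective R M] (v : V) : hb.socle M v ≤ hb.rad M v := by
  intro m hm
  obtain ⟨f, hf⟩ := Module.projective_def.1 ‹Module.Projective R M›
  rw [← hf m]
  refine hb.map_mem_rad _ ?_
  rw [← Finsupp.sum_single (f m)]
  refine Submodule.sum_mem _ fun i _ => ?_
  have h1 : f m i ∈ hb.rad R v := hb.socle_le_rad_self hs v
    (hb.map_mem_socle (Finsupp.lapply i ∘ₗ f) hm)
  exact hb.map_mem_rad (Finsupp.lsingle i) h1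

/-! ### Superfluous submodules -/

section Functional

variable [Module K M] [IsScalarTower K R M]

/-- The submodule cut out at the vertex `v` by a functional that vanishes on the radical. -/
def functionalKer (hb : IsRadSqZeroBasis b s t) (v : V) (l : M →ₗ[K] K)
    (hl : ∀ α m, l (b (.inr α) • m) = 0) : Submodule R M where
  carrier := {m | l (b (.inl v) • m) = 0}
  zero_mem' := by simp
  add_mem' := by
    intro m n (h1 : _ = _) (h2 : _ = _)
    change l _ = 0
    rw [smul_add, map_add, h1, h2, add_zero]
  smul_mem' := by
    classical
    intro r m (h : _ = _)
    change l _ = 0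
    rw [smul_smul, hb.vertex_mul, add_smul, Finset.sum_smul, map_add, map_sum, smul_assoc,
      map_smul, h, smul_zero, zero_add]
    refine Finset.sum_eq_zero fun α _ => ?_
    rw [smul_assoc, map_smul, hl, smul_zero]

theorem mem_functionalKer (hb : IsRadSqZeroBasis b s t) {v : V} {l : M →ₗ[K] K}
    {hl : ∀ α m, l (b (.inr α) • m) = 0} {m : M} :
    m ∈ hb.functionalKer v l hl ↔ l (b (.inl v) • m) = 0 := Iff.rfl

theorem functionalKer_sup (hb : IsRadSqZeroBasis b s t) {v : V} {l : M →ₗ[K] K}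
    (hl : ∀ α m, l (b (.inr α) • m) = 0) {n : M} (hn : l (b (.inl v) • n) ≠ 0) :
    hb.functionalKer v l hl ⊔ Submodule.span R {n} = ⊤ := by
  refine eq_top_iff.2 fun m _ => ?_
  -- Chosen so that `m - c n` lies in the kernel of the functional at `v`.
  set c : K := l (b (.inl v) • m) / l (b (.inl v) • n) with hc
  have h : m = (m - algebraMap K R c • n) + algebraMap K R c • n := by abel
  rw [h]
  refine Submodule.add_mem_sup ?_ (Submodule.smul_mem _ _ (Submodule.mem_span_singleton_self n))
  rw [mem_functionalKer, smul_sub, smul_smul, ← Algebra.commutes, mul_smul, l.map_sub,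
    algebraMap_smul, l.map_smul, hc, smul_eq_mul, div_mul_cancel₀ _ hn, sub_self]

end Functional

/-- If some component of `n` were outside the radical, a `K`-functional would separate the two. It
cuts out a proper submodule which together with `n` spans `M`, against superfluity. -/
theorem mem_iSup_rad_of_isSuperfluous (hb : IsRadSqZeroBasis b s t) {X : Submodule R M}
    (hX : IgusaTodorov.IsSuperfluous X) {n : M} (hn : n ∈ X) : n ∈ ⨆ v, hb.rad M v := by
  let _ : Module K M := Module.compHom M (algebraMap K R)
  have : IsScalarTower K R M := ⟨fun c r m => by
    rw [Algebra.smul_def, mul_smul]; rfl⟩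
  rw [← hb.sum_vertex_smul n]
  refine Submodule.sum_mem _ fun v _ => ?_
  by_contra hv
  obtain ⟨l, hl, hl'⟩ := Submodule.exists_le_ker_of_notMem
    (p := (⨆ v, hb.rad M v).restrictScalars K) (v := b (.inl v) • n) hv
  have hlJ : ∀ α m, l (b (.inr α) • m) = 0 := fun α m =>
    hl' (Submodule.mem_iSup_of_mem (p := fun v => hb.rad M v) (t α)
      (Submodule.subset_span ⟨α, m, rfl, rfl⟩))
  have htop := hX (hb.functionalKer v l hlJ) (eq_top_iff.2 <| by
    rw [← hb.functionalKer_sup hlJ hl]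
    exact sup_le_sup le_rfl (by simpa using hn))
  exact hl (hb.mem_functionalKer.1 (htop ▸ Submodule.mem_top : n ∈ hb.functionalKer v l hlJ))

/-- Applied to the kernel of a projective cover, this makes syzygies semisimple. -/
theorem arrow_smul_of_isSuperfluous (hb : IsRadSqZeroBasis b s t) {X : Submodule R M}
    (hX : IgusaTodorov.IsSuperfluous X) (x : X) (α : E) : b (.inr α) • x = 0 := by
  apply Subtype.ext
  change b (.inr α) • (x : M) = 0
  refine Submodule.iSup_induction (fun v => hb.rad M v)
    (motive := fun m => b (.inr α) • m = 0) (hb.mem_iSup_rad_of_isSuperfluous hX x.2)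
    (fun v m hm => (hb.rad_le_socle v hm).2 α) (smul_zero _) ?_
  intro m m' h h'
  rw [smul_add, h, h', add_zero]

theorem exists_target_of_isSuperfluous (hb : IsRadSqZeroBasis b s t) {X : Submodule R M}
    (hX : IgusaTodorov.IsSuperfluous X) {n : M} (hn : n ∈ X) {v : V}
    (h : b (.inl v) • n ≠ 0) : ∃ α, t α = v := by
  by_contra! hv
  apply h
  refine Submodule.iSup_induction (fun v => hb.rad M v)
    (motive := fun m => b (.inl v) • m = 0) (hb.mem_iSup_rad_of_isSuperfluous hX hn)
    (fun u m hm => ?_) (smul_zero _) ?_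
  · by_cases huv : u = v
    · subst huv
      have : hb.rad M u = ⊥ := by
        rw [rad, Submodule.span_eq_bot]
        rintro _ ⟨α, _, hα, _⟩
        exact absurd hα (hv α)
      rw [this, Submodule.mem_bot] at hm
      rw [hm, smul_zero]
    · rw [← (hb.rad_le_socle u hm).1, smul_smul, hb.vertex_mul_vertex _ _ (Ne.symm huv),
        zero_smul]
  · intro m m' h h'
    rw [smul_add, h, h', add_zero]

/-- Without an arrow out of `v`, the ring acts on `b (.inl v) • n` by scalars. The submodule
generated by this element then meets `X` trivially unless the element is in `X`. -/
theorem exists_source_of_isEssential (hb : IsRadSqZeroBasis b s t) {X : Submodule R M}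
    (hX : IgusaTodorov.IsEssential X) {n : M} {v : V} (h : b (.inl v) • n ∉ X) :
    ∃ α, s α = v := by
  by_contra! hv
  have key : ∀ r : R, r • b (.inl v) • n = algebraMap K R (b.repr r (.inl v)) • b (.inl v) • n :=
    hb.smul_eq_of_socle (by rw [smul_smul, hb.vertex_mul_self])
      fun α => by rw [smul_smul, hb.arrow_mul_vertex (hv α), zero_smul]
  have hbot := hX (Submodule.span R {b (.inl v) • n}) <| by
    refine eq_bot_iff.2 ?_
    rintro m ⟨hm, hmX⟩
    obtain ⟨r, rfl⟩ := Submodule.mem_span_singleton.1 hm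
    rw [key] at hmX ⊢
    by_cases hc : b.repr r (.inl v) = 0
    · simp [hc]
    · refine absurd ?_ h
      have := X.smul_mem (algebraMap K R (b.repr r (.inl v))⁻¹) hmX
      rwa [smul_smul, ← map_mul, inv_mul_cancel₀ hc, map_one, one_smul] at this
  apply h
  rw [Submodule.span_singleton_eq_bot] at hbot
  rw [hbot]
  exact X.zero_mem

end IsRadSqZeroBasis

/-! ### The group `K₀` and kernel criteria for the `φ`-dimension. -/

namespace IgusaTodorov

variable {R : Type u} [Ring R]

theorem K0_induction {H : AddSubgroup (K0 R)} (h : ∀ M : FGModuleCat.{u} R, cls M ∈ H)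
    (x : K0 R) : x ∈ H := by
  obtain ⟨y, rfl⟩ := QuotientAddGroup.mk_surjective x
  induction y using FreeAbelianGroup.induction_on with
  | zero => exact H.zero_mem
  | of M => exact h M
  | neg M hM => exact H.neg_mem hM
  | add x y hx hy => exact H.add_mem hx hy

theorem cls_subsingleton (M : FGModuleCat.{u} R) [Subsingleton M] : cls M = 0 :=
  cls_projective M inferInstance

theorem cls_sup_of_disjoint {M : Type u} [AddCommGroup M] [Module R M] [IsNoetherian R M]
    {X Y : Submodule R M} (h : Disjoint X Y) :
    cls (FGModuleCat.of R ↥(X ⊔ Y)) = cls (FGModuleCat.of R X) + cls (FGModuleCat.of R Y) := by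
  have hinj : Function.Injective (X.subtype.coprod Y.subtype) := by
    rw [← LinearMap.ker_eq_bot, LinearMap.ker_coprod_of_disjoint_range, Submodule.ker_subtype,
      Submodule.ker_subtype, Submodule.prod_bot]
    simpa using h
  exact cls_prod (((LinearEquiv.ofInjective _ hinj).trans
    (LinearEquiv.ofEq _ _ (Submodule.sup_eq_range X Y).symm)).symm)

section AddSpan

theorem addSpan_le_of_equiv {M M' M'' : FGModuleCat.{u} R} (e : M ≃ₗ[R] (M' × M'')) :
    addSpan M' ≤ addSpan M := by
  refine AddSubgroup.closure_mono ?_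
  rintro _ ⟨N, N', hN, ⟨f⟩, rfl⟩
  exact ⟨N, FGModuleCat.of R (N' × M''), hN,
    ⟨e.trans ((f.prodCongr (LinearEquiv.refl R M'')).trans (LinearEquiv.prodAssoc R N N' M''))⟩, rfl⟩

variable [IsArtinianRing R]

theorem length_lt_of_equiv_prod {M X Y : FGModuleCat.{u} R} (e : M ≃ₗ[R] (X × Y))
    [Nontrivial Y] : Module.length R X < Module.length R M := by
  rw [e.length_eq, Module.length_prod]
  simpa using (ENat.add_lt_add_iff_left (k := Module.length R X) Module.length_ne_top).2
    (Module.length_pos (R := R) (M := Y))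

/-- The class of a module is in the span of the classes of its indecomposable summands. -/
theorem cls_mem_addSpan (M : FGModuleCat.{u} R) : cls M ∈ addSpan M := by
  induction hl : Module.length R M using WellFoundedLT.induction generalizing M with
  | ind l ih =>
  rcases subsingleton_or_nontrivial M with _ | hM
  · rw [cls_subsingleton]
    exact zero_mem _
  by_cases hind : IsIndecomposable M
  · exact AddSubgroup.subset_closure ⟨M, FGModuleCat.of R PUnit.{u + 1}, hind,
      ⟨(LinearEquiv.prodUnique (R := R) (M := M) (M₂ := PUnit.{u + 1})).symm⟩, rfl⟩
  · simp only [IsIndecomposable, hM, true_and, not_forall, not_or,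
      not_subsingleton_iff_nontrivial] at hind
    obtain ⟨X, Y, ⟨e⟩, hX, hY⟩ := hind
    have e' := e.trans (LinearEquiv.prodComm R X Y)
    rw [cls_prod e]
    exact add_mem
      (addSpan_le_of_equiv e (ih _ (hl ▸ length_lt_of_equiv_prod e) X rfl))
      (addSpan_le_of_equiv e' (ih _ (hl ▸ length_lt_of_equiv_prod e') Y rfl))

/-- Lets `φ`, defined one module at a time, be tested on arbitrary elements of `K₀`: direct sums of
modules absorb sums of classes. -/
theorem exists_mem_addSpan (x : K0 R) : ∃ M : FGModuleCat.{u} R, x ∈ addSpan M := by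
  obtain ⟨y, rfl⟩ := QuotientAddGroup.mk_surjective x
  induction y using FreeAbelianGroup.induction_on with
  | zero => exact ⟨FGModuleCat.of R PUnit.{u + 1}, zero_mem _⟩
  | of M => exact ⟨M, cls_mem_addSpan M⟩
  | neg M hM =>
    obtain ⟨N, hN⟩ := hM
    exact ⟨N, neg_mem hN⟩
  | add x y hx hy =>
    obtain ⟨X, hX⟩ := hx
    obtain ⟨Y, hY⟩ := hy
    exact ⟨FGModuleCat.of R (X × Y), add_mem
      (addSpan_le_of_equiv (M := FGModuleCat.of R (X × Y)) (LinearEquiv.refl R _) hX)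
      (addSpan_le_of_equiv (M := FGModuleCat.of R (X × Y)) (LinearEquiv.prodComm R X Y) hY)⟩

end AddSpan

section PhiDim

variable [IsArtinianRing R]

/-- Two elements of `Ω̄ⁿ⟨add M⟩` with equal image differ by some `Ω̄ⁿ x` in the kernel of `Ω̄`, so
injectivity only concerns the growth of the kernels of the powers. -/
theorem phiDim_le {k : ℕ} (h : ∀ (n : ℕ) (x : K0 R), k ≤ n →
    (syzygyMap R)^[n + 1] x = 0 → (syzygyMap R)^[n] x = 0) : phiDim R ≤ k := by
  refine iSup_le fun M => iInf₂_le k ?_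
  rintro s _ ⟨x, -, rfl⟩ _ ⟨y, -, rfl⟩ hxy
  rw [← Function.iterate_succ_apply' (syzygyMap R),
    ← Function.iterate_succ_apply' (syzygyMap R)] at hxy
  rw [← sub_eq_zero, ← iterate_map_sub] at hxy ⊢
  exact h _ _ (Nat.le_add_right k s) hxy

/-- Choose `M` with `x` in `⟨add M⟩`. Injectivity fails on `Ω̄ᵏ⟨add M⟩`, where `Ω̄ᵏ x` and `0` have
the same image, so no `l ≤ k` is admissible for `φ(M)`. -/
theorem le_phiDim {k : ℕ} {x : K0 R} (h : (syzygyMap R)^[k + 1] x = 0)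
    (h' : (syzygyMap R)^[k] x ≠ 0) : ((k + 1 : ℕ) : ℕ∞) ≤ phiDim R := by
  obtain ⟨M, hM⟩ := exists_mem_addSpan x
  refine le_trans (le_iInf₂ fun l hl => ?_) (le_iSup (fun M : FGModuleCat.{u} R => phi M) M)
  by_contra! hlt
  have hlk : l ≤ k := by
    have : l < k + 1 := by exact_mod_cast hlt
    omega
  have := hl (k - l)
  rw [Nat.add_sub_cancel' hlk] at this
  refine h' (this ⟨x, hM, rfl⟩ ⟨0, zero_mem _, iterate_map_zero _ _⟩ ?_)
  rw [← Function.iterate_succ_apply' (syzygyMap R), h, map_zero]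

end PhiDim

end IgusaTodorov

namespace IsRadSqZeroBasis

open IgusaTodorov

variable {K : Type z} [Field K] {R : Type u} [Ring R] [Algebra K R] {V : Type v} {E : Type w}
  [Fintype V] [Fintype E] {b : Module.Basis (V ⊕ E) K R} {s t : E → V}

/-! ### The multiplicity of a simple module as a direct summand -/

theorem mem_socle_equiv_prod (hb : IsRadSqZeroBasis b s t) {M M' M'' : Type*} [AddCommGroup M]
    [Module R M] [AddCommGroup M'] [Module R M'] [AddCommGroup M''] [Module R M'']
    (e : M ≃ₗ[R] (M' × M'')) {v : V} {m : M} :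
    m ∈ hb.socle M v ↔ (e m).1 ∈ hb.socle M' v ∧ (e m).2 ∈ hb.socle M'' v := by
  constructor
  · intro h
    exact ⟨hb.map_mem_socle (LinearMap.fst R M' M'' ∘ₗ e.toLinearMap) h,
      hb.map_mem_socle (LinearMap.snd R M' M'' ∘ₗ e.toLinearMap) h⟩
  · rintro ⟨h1, h2⟩
    have := add_mem (hb.map_mem_socle (e.symm.toLinearMap ∘ₗ LinearMap.inl R M' M'') h1)
      (hb.map_mem_socle (e.symm.toLinearMap ∘ₗ LinearMap.inr R M' M'') h2)
    simpa [← map_add] using this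

theorem mem_rad_equiv_prod (hb : IsRadSqZeroBasis b s t) {M M' M'' : Type*} [AddCommGroup M]
    [Module R M] [AddCommGroup M'] [Module R M'] [AddCommGroup M''] [Module R M'']
    (e : M ≃ₗ[R] (M' × M'')) {v : V} {m : M} :
    m ∈ hb.rad M v ↔ (e m).1 ∈ hb.rad M' v ∧ (e m).2 ∈ hb.rad M'' v := by
  constructor
  · intro h
    exact ⟨hb.map_mem_rad (LinearMap.fst R M' M'' ∘ₗ e.toLinearMap) h,
      hb.map_mem_rad (LinearMap.snd R M' M'' ∘ₗ e.toLinearMap) h⟩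
  · rintro ⟨h1, h2⟩
    have := add_mem (hb.map_mem_rad (e.symm.toLinearMap ∘ₗ LinearMap.inl R M' M'') h1)
      (hb.map_mem_rad (e.symm.toLinearMap ∘ₗ LinearMap.inr R M' M'') h2)
    simpa [← map_add] using this

theorem length_eq_of_equiv_prod {R : Type*} [Ring R] {M M' M'' : Type*} [AddCommGroup M]
    [Module R M] [AddCommGroup M'] [Module R M'] [AddCommGroup M''] [Module R M'']
    (e : M ≃ₗ[R] (M' × M'')) {X : Submodule R M} {X' : Submodule R M'} {X'' : Submodule R M''}
    (h : ∀ m, m ∈ X ↔ (e m).1 ∈ X' ∧ (e m).2 ∈ X'') :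
    Module.length R X = Module.length R X' + Module.length R X'' := by
  have E : X ≃ₗ[R] (X' × X'') :=
    { toFun := fun x => (⟨(e x).1, ((h _).1 x.2).1⟩, ⟨(e x).2, ((h _).1 x.2).2⟩)
      map_add' := fun x y => by ext <;> simp
      map_smul' := fun r x => by ext <;> simp
      invFun := fun y => ⟨e.symm (y.1, y.2), (h _).2 (by simp)⟩
      left_inv := fun x => by ext; simp
      right_inv := fun y => by ext <;> simp }
  rw [E.length_eq, Module.length_prod]

section Multiplicity

variable [IsArtinianRing R]

/-- The multiplicity of the simple module at `v` as a direct summand of `M`. -/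
def mult (hb : IsRadSqZeroBasis b s t) (M : FGModuleCat.{u} R) (v : V) : ℤ :=
  (Module.length R (hb.socle M v)).toNat - (Module.length R (hb.rad M v)).toNat

theorem mult_prod (hb : IsRadSqZeroBasis b s t) {M M' M'' : FGModuleCat.{u} R}
    (e : M ≃ₗ[R] (M' × M'')) : hb.mult M = hb.mult M' + hb.mult M'' := by
  ext v
  rw [mult, length_eq_of_equiv_prod e fun m => hb.mem_socle_equiv_prod e,
    length_eq_of_equiv_prod e fun m => hb.mem_rad_equiv_prod e,
    ENat.toNat_add Module.length_ne_top Module.length_ne_top,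
    ENat.toNat_add Module.length_ne_top Module.length_ne_top, Pi.add_apply, mult, mult]
  push_cast
  ring

theorem mult_eq_zero (hb : IsRadSqZeroBasis b s t) {M : FGModuleCat.{u} R}
    (h : ∀ v, hb.socle M v ≤ hb.rad M v) : hb.mult M = 0 := by
  ext v
  rw [mult, le_antisymm (h v) (hb.rad_le_socle v), sub_self, Pi.zero_apply]

/-- The multiplicities of the simple modules as a homomorphism on `K₀`. -/
def multHom (hb : IsRadSqZeroBasis b s t) (hs : Function.Surjective s) : K0 R →+ (V → ℤ) :=
  QuotientAddGroup.lift _ (FreeAbelianGroup.lift fun M => hb.mult M) <| by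
    rw [AddSubgroup.closure_le]
    rintro x (⟨M, M', M'', ⟨e⟩, rfl⟩ | ⟨P, hP, rfl⟩)
    · simp [AddMonoidHom.mem_ker, hb.mult_prod e]
    · simp [AddMonoidHom.mem_ker,
        hb.mult_eq_zero fun v => hb.socle_le_rad_of_projective (M := P) hs v]

theorem multHom_cls (hb : IsRadSqZeroBasis b s t) (hs : Function.Surjective s)
    (M : FGModuleCat.{u} R) : hb.multHom hs (cls M) = hb.mult M := by
  simp [multHom, cls]

end Multiplicity

/-! ### Quotients of the indecomposable projective modules -/

/-- The projective left ideal generated by the idempotent at `v`. -/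
def vertexProj (_ : IsRadSqZeroBasis b s t) (v : V) : Submodule R R :=
  Submodule.span R {b (.inl v)}

theorem mul_vertex_of_mem (hb : IsRadSqZeroBasis b s t) {v : V} {r : R}
    (h : r ∈ hb.vertexProj v) : r * b (.inl v) = r := by
  obtain ⟨r, rfl⟩ := Submodule.mem_span_singleton.1 h
  rw [smul_eq_mul, mul_assoc, hb.vertex_mul_self]

theorem vertex_mem_vertexProj (hb : IsRadSqZeroBasis b s t) (v : V) :
    b (.inl v) ∈ hb.vertexProj v := Submodule.mem_span_singleton_self _

theorem arrow_mem_vertexProj (hb : IsRadSqZeroBasis b s t) (α : E) :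
    b (.inr α) ∈ hb.vertexProj (s α) :=
  Submodule.mem_span_singleton.2 ⟨b (.inr α), hb.arrow_mul_source α⟩

theorem projective_vertexProj (hb : IsRadSqZeroBasis b s t) (v : V) :
    Module.Projective R (hb.vertexProj v) := by
  refine Module.Projective.of_split (hb.vertexProj v).subtype
    (LinearMap.codRestrict _ (LinearMap.toSpanSingleton R R (b (.inl v)))
      fun r => Submodule.mem_span_singleton.2 ⟨r, rfl⟩) ?_
  ext x
  exact hb.mul_vertex_of_mem x.2

/-- The left ideal generated by a set of arrows. -/
def arrowSpan (_ : IsRadSqZeroBasis b s t) (F : Set E) : Submodule R R :=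
  Submodule.span R ((fun α => b (.inr α)) '' F)

theorem arrowSpan_le_vertexProj (hb : IsRadSqZeroBasis b s t) {F : Set E} {v : V}
    (h : ∀ α ∈ F, s α = v) : hb.arrowSpan F ≤ hb.vertexProj v := by
  rw [arrowSpan, Submodule.span_le]
  rintro _ ⟨α, hα, rfl⟩
  exact h α hα ▸ hb.arrow_mem_vertexProj α

theorem arrow_mem_socle (hb : IsRadSqZeroBasis b s t) (α : E) :
    b (.inr α) ∈ hb.socle R (t α) :=
  ⟨hb.target_mul_arrow α, fun β => hb.arrow_mul_arrow β α⟩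

theorem mul_arrow (hb : IsRadSqZeroBasis b s t) (α : E) (r : R) :
    r * b (.inr α) = b.repr r (.inl (t α)) • b (.inr α) := by
  rw [Algebra.smul_def]
  exact hb.smul_eq_of_socle (hb.arrow_mem_socle α).1 (hb.arrow_mem_socle α).2 r

/-- Left multiplication only rescales an arrow, so the left ideal generated by arrows is no larger
than their `K`-span. Linear independence of the basis then controls such ideals. -/
theorem arrowSpan_le_span (hb : IsRadSqZeroBasis b s t) (F : Set E) :
    (hb.arrowSpan F).restrictScalars K ≤ Submodule.span K (b '' (Sum.inr '' F)) := by
  intro y (hy : y ∈ hb.arrowSpan F)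
  refine Submodule.span_induction (p := fun y _ => y ∈ Submodule.span K (b '' (Sum.inr '' F)))
    (fun y hy => ?_) ?_ ?_ ?_ hy
  · obtain ⟨α, hα, rfl⟩ := hy
    exact Submodule.subset_span ⟨_, ⟨α, hα, rfl⟩, rfl⟩
  · exact zero_mem _
  · exact fun _ _ _ _ => add_mem
  · intro r y _ hy
    refine Submodule.span_induction
      (p := fun y _ => r • y ∈ Submodule.span K (b '' (Sum.inr '' F))) ?_ ?_ ?_ ?_ hy
    · rintro _ ⟨_, ⟨α, hα, rfl⟩, rfl⟩
      rw [smul_eq_mul, hb.mul_arrow]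
      exact Submodule.smul_mem _ _ (Submodule.subset_span ⟨_, ⟨α, hα, rfl⟩, rfl⟩)
    · simp
    · intro x y _ _ hx hy
      rw [smul_add]
      exact add_mem hx hy
    · intro c x _ hx
      rw [smul_comm]
      exact Submodule.smul_mem _ _ hx

theorem disjoint_arrowSpan (hb : IsRadSqZeroBasis b s t) {F G : Set E} (h : Disjoint F G) :
    Disjoint (hb.arrowSpan F) (hb.arrowSpan G) := by
  have := b.linearIndependent.disjoint_span_image
    ((Set.disjoint_image_iff Sum.inr_injective).2 h : Disjoint (Sum.inr '' F : Set (V ⊕ E)) _)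
  rw [Submodule.disjoint_def] at this ⊢
  exact fun x hx hy => this x (hb.arrowSpan_le_span F hx) (hb.arrowSpan_le_span G hy)

theorem repr_arrowSpan (hb : IsRadSqZeroBasis b s t) {F : Set E} {r : R}
    (hr : r ∈ hb.arrowSpan F) {i : V ⊕ E} (hi : i ∉ (Sum.inr '' F : Set (V ⊕ E))) :
    b.repr r i = 0 := by
  have h : r ∈ Submodule.span K (b '' (Sum.inr '' F)) := hb.arrowSpan_le_span F hr
  rw [b.mem_span_image] at h
  exact Finsupp.notMem_support_iff.1 fun hi' => hi (h hi')

theorem mem_arrowSpan (hb : IsRadSqZeroBasis b s t) {v : V} {r : R} (hr : r ∈ hb.vertexProj v)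
    (h : b.repr r (.inl v) = 0) : r ∈ hb.arrowSpan {α | s α = v} := by
  classical
  have h0 : ∀ u, b.repr r (.inl u) = 0 := by
    intro u
    rw [← hb.mul_vertex_of_mem hr, hb.repr_mul_vertex]
    split_ifs with hu
    · rw [hu, h]
    · rfl
  rw [← hb.mul_vertex_of_mem hr, expand b r]
  simp only [h0, zero_smul, Finset.sum_const_zero, zero_add, Finset.sum_mul]
  refine Submodule.sum_mem _ fun α _ => ?_
  rw [smul_mul_assoc]
  by_cases hα : s α = v
  · rw [← hα, hb.arrow_mul_source, Algebra.smul_def, hα]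
    exact Submodule.smul_mem _ _ (Submodule.subset_span ⟨α, hα, rfl⟩)
  · rw [hb.arrow_mul_vertex hα, smul_zero]
    exact zero_mem _

variable [IsArtinianRing R]

/-- The quotient of the projective module at `v` by `W`. -/
def vertexQuot (hb : IsRadSqZeroBasis b s t) (v : V) (W : Submodule R R) : FGModuleCat.{u} R :=
  FGModuleCat.of R (hb.vertexProj v ⧸ W.comap (hb.vertexProj v).subtype)

/-- The projection from the projective module at `v`. -/
def vertexQuotMk (hb : IsRadSqZeroBasis b s t) (v : V) (W : Submodule R R) :
    hb.vertexProj v →ₗ[R] hb.vertexQuot v W :=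
  Submodule.mkQ (W.comap (hb.vertexProj v).subtype)

theorem vertexQuotMk_surjective (hb : IsRadSqZeroBasis b s t) (v : V) (W : Submodule R R) :
    Function.Surjective (hb.vertexQuotMk v W) := Submodule.mkQ_surjective _

theorem vertexQuotMk_eq_zero (hb : IsRadSqZeroBasis b s t) {v : V} {W : Submodule R R}
    {p : hb.vertexProj v} : hb.vertexQuotMk v W p = 0 ↔ (p : R) ∈ W :=
  Submodule.Quotient.mk_eq_zero _

/-- The generator of a quotient of the projective module at `v`. -/
def vertexQuotGen (hb : IsRadSqZeroBasis b s t) (v : V) (W : Submodule R R) :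
    hb.vertexQuot v W := hb.vertexQuotMk v W ⟨_, hb.vertex_mem_vertexProj v⟩

theorem smul_vertexQuotGen (hb : IsRadSqZeroBasis b s t) {v : V} {W : Submodule R R}
    (p : hb.vertexProj v) : (p : R) • hb.vertexQuotGen v W = hb.vertexQuotMk v W p := by
  rw [vertexQuotGen, ← map_smul]
  exact congrArg _ (Subtype.ext (hb.mul_vertex_of_mem p.2))

/-- By Schanuel's lemma any projective presentation computes the class of the syzygy, so `W` need
not be superfluous. -/
theorem cls_syzygy_vertexQuot (hb : IsRadSqZeroBasis b s t) {v : V} {W : Submodule R R}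
    (hW : W ≤ hb.vertexProj v) :
    cls (syzygy (hb.vertexQuot v W)) = cls (FGModuleCat.of R W) := by
  have : Module.Projective R (FGModuleCat.of R (hb.vertexProj v)) := hb.projective_vertexProj v
  refine cls_syzygy_eq (M := hb.vertexQuot v W) (P := FGModuleCat.of R (hb.vertexProj v))
    (hb.vertexQuotMk v W) (hb.vertexQuotMk_surjective v W) ?_
  exact (Submodule.comapSubtypeEquivOfLe hW).symm.trans
    (LinearEquiv.ofEq _ _ (Submodule.ker_mkQ _).symm)

/-- The simple module at the vertex `v`. -/
abbrev simple (hb : IsRadSqZeroBasis b s t) (v : V) : FGModuleCat.{u} R :=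
  hb.vertexQuot v (hb.arrowSpan {α | s α = v})

/-- On a socle element at `v` the ring acts through the coefficient at `v`; inside the projective
module at `v`, the annihilator is thus spanned by the arrows. -/
theorem simple_equiv_span (hb : IsRadSqZeroBasis b s t) {M : Type u} [AddCommGroup M]
    [Module R M] {v : V} {n : M} (hn : n ∈ hb.socle M v) (hn0 : n ≠ 0) :
    Nonempty (hb.simple v ≃ₗ[R] Submodule.span R {n}) := by
  let f : hb.vertexProj v →ₗ[R] M :=
    LinearMap.toSpanSingleton R M n ∘ₗ (hb.vertexProj v).subtype
  have hf : ∀ p, f p = (p : R) • n := fun p => rfl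
  have hker : LinearMap.ker f =
      (hb.arrowSpan {α | s α = v}).comap (hb.vertexProj v).subtype := by
    ext p
    rw [LinearMap.mem_ker, hf, Submodule.mem_comap, Submodule.subtype_apply,
      hb.smul_eq_of_socle hn.1 hn.2]
    constructor
    · intro h
      refine hb.mem_arrowSpan p.2 ?_
      by_contra hc
      apply hn0
      rw [← one_smul R n, ← map_one (algebraMap K R), ← inv_mul_cancel₀ hc, map_mul, mul_smul, h,
        smul_zero]
    · intro h
      rw [hb.repr_arrowSpan h (by simp), map_zero, zero_smul]
  have hrange : LinearMap.range f = Submodule.span R {n} := by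
    refine le_antisymm ?_ ?_
    · rintro _ ⟨p, rfl⟩
      exact Submodule.smul_mem _ _ (Submodule.mem_span_singleton_self n)
    · rw [Submodule.span_singleton_le_iff_mem]
      exact ⟨⟨_, hb.vertex_mem_vertexProj v⟩, hn.1⟩
  exact ⟨(Submodule.quotEquivOfEq _ _ hker.symm).trans
    (f.quotKerEquivRange.trans (LinearEquiv.ofEq _ _ hrange))⟩

theorem socle_simple (hb : IsRadSqZeroBasis b s t) (v : V) : hb.socle (hb.simple v) v = ⊤ := by
  classical
  refine eq_top_iff.2 ?_
  rintro y -
  obtain ⟨p, rfl⟩ := hb.vertexQuotMk_surjective _ _ y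
  constructor
  · rw [← map_smul, ← sub_eq_zero, ← map_sub, vertexQuotMk_eq_zero]
    refine hb.mem_arrowSpan (Submodule.coe_mem _) ?_
    simp [hb.vertex_mul]
  · intro α
    rw [← map_smul, vertexQuotMk_eq_zero]
    refine hb.mem_arrowSpan (Submodule.coe_mem _) ?_
    simp [hb.arrow_mul]

theorem mem_socle_simple (hb : IsRadSqZeroBasis b s t) {v : V} (y : hb.simple v) :
    y ∈ hb.socle (hb.simple v) v := by
  rw [hb.socle_simple]
  exact Submodule.mem_top

theorem length_simple (hb : IsRadSqZeroBasis b s t) (v : V) :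
    Module.length R (hb.simple v) = 1 := by
  rw [Module.length_eq_one_iff, isSimpleModule_iff_toSpanSingleton_surjective]
  let g : hb.simple v := hb.vertexQuotGen v _
  have hspan : ∀ y : hb.simple v, ∃ c : K, y = algebraMap K R c • g := by
    intro y
    obtain ⟨p, rfl⟩ := hb.vertexQuotMk_surjective _ _ y
    have hg := hb.mem_socle_simple g
    refine ⟨b.repr (p : R) (.inl v), ?_⟩
    rw [← hb.smul_eq_of_socle hg.1 hg.2]
    exact (hb.smul_vertexQuotGen p).symm
  constructor
  · refine ⟨g, 0, fun h => ?_⟩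
    have := hb.repr_arrowSpan (hb.vertexQuotMk_eq_zero.1 h) (i := .inl v) (by simp)
    simp at this
  · intro y hy x
    obtain ⟨c, hc⟩ := hspan y
    obtain ⟨d, hd⟩ := hspan x
    have hc0 : c ≠ 0 := by
      intro h
      exact hy (by rw [hc, h, map_zero, zero_smul])
    refine ⟨algebraMap K R (d * c⁻¹), ?_⟩
    rw [LinearMap.toSpanSingleton_apply, hc, hd, smul_smul, ← map_mul,
      inv_mul_cancel_right₀ hc0]

theorem mult_simple (hb : IsRadSqZeroBasis b s t) [DecidableEq V] (v : V) :
    hb.mult (hb.simple v) = Pi.single v 1 := by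
  ext w
  have hx : ∀ y : hb.simple v, b (.inl v) • y = y ∧ ∀ α, b (.inr α) • y = 0 := fun y =>
    hb.mem_socle_simple y
  have hrad : hb.rad (hb.simple v) w = ⊥ := by
    rw [rad, Submodule.span_eq_bot]
    rintro _ ⟨α, n, -, rfl⟩
    exact (hx n).2 α
  rw [mult, hrad, Module.length_bot]
  by_cases h : w = v
  · subst h
    rw [hb.socle_simple, Module.length_top, hb.length_simple]
    simp
  · have : hb.socle (hb.simple v) w = ⊥ := by
      refine eq_bot_iff.2 fun y hy => ?_
      rw [Submodule.mem_bot, ← hy.1, ← (hx y).1, smul_smul, hb.vertex_mul_vertex _ _ h, zero_smul]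
    rw [this, Module.length_bot]
    simp [h]

/-! ### Classes of semisimple modules -/

/-- The classes of the semisimple modules. -/
def semisimpleCls (hb : IsRadSqZeroBasis b s t) : (V → ℤ) →+ K0 R where
  toFun z := ∑ v, z v • cls (hb.simple v)
  map_zero' := by simp
  map_add' x y := by simp [add_smul, Finset.sum_add_distrib]

theorem semisimpleCls_apply (hb : IsRadSqZeroBasis b s t) (z : V → ℤ) :
    hb.semisimpleCls z = ∑ v, z v • cls (hb.simple v) := rfl

theorem semisimpleCls_single (hb : IsRadSqZeroBasis b s t) [DecidableEq V] (v : V) :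
    hb.semisimpleCls (Pi.single v 1) = cls (hb.simple v) := by
  rw [semisimpleCls_apply, Finset.sum_eq_single v]
  · simp
  · intro w _ h
    simp [h]
  · simp

theorem multHom_semisimpleCls (hb : IsRadSqZeroBasis b s t) (hs : Function.Surjective s)
    (z : V → ℤ) : hb.multHom hs (hb.semisimpleCls z) = z := by
  classical
  rw [semisimpleCls_apply, map_sum]
  simp only [map_zsmul, multHom_cls, mult_simple]
  ext v
  simp [Finset.sum_apply, Pi.single_apply]

/-- Induction on the length. When arrows act as zero every `K`-functional vanishes on the radical,
so its kernel at `v` is a complement to a simple submodule, which splits off. -/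
theorem cls_mem_range_of_arrow_smul (hb : IsRadSqZeroBasis b s t) (N : FGModuleCat.{u} R)
    (hN : ∀ (α : E) (n : N), b (.inr α) • n = 0) : cls N ∈ hb.semisimpleCls.range := by
  classical
  induction hl : Module.length R N using WellFoundedLT.induction generalizing N with
  | ind l ih =>
  rcases subsingleton_or_nontrivial N with _ | hnt
  · rw [cls_subsingleton]
    exact zero_mem _
  obtain ⟨n, hn0⟩ := exists_ne (0 : N)
  obtain ⟨v, hv⟩ : ∃ v, b (.inl v) • n ≠ 0 := by
    by_contra! h
    exact hn0 (by rw [← hb.sum_vertex_smul n, Finset.sum_eq_zero fun v _ => h v])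
  let _ : Module K N := Module.compHom N (algebraMap K R)
  have : IsScalarTower K R N := ⟨fun c r m => by
    rw [Algebra.smul_def, mul_smul]; rfl⟩
  have hsoc : b (.inl v) • n ∈ hb.socle N v :=
    ⟨by rw [smul_smul, hb.vertex_mul_self], fun α => hN α _⟩
  obtain ⟨l, hlv⟩ := Module.Projective.exists_dual_ne_zero K hv
  have hl0 : ∀ α (m : N), l (b (.inr α) • m) = 0 := fun α m => by rw [hN, map_zero]
  have hlv' : l (b (.inl v) • b (.inl v) • n) ≠ 0 := by rwa [hsoc.1]
  have hcompl : IsCompl (hb.functionalKer v l hl0) (Submodule.span R {b (.inl v) • n}) := by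
    refine ⟨Submodule.disjoint_def.2 fun x hx hx' => ?_, codisjoint_iff.2
      (hb.functionalKer_sup hl0 hlv')⟩
    obtain ⟨r, rfl⟩ := Submodule.mem_span_singleton.1 hx'
    rw [hb.smul_eq_of_socle hsoc.1 hsoc.2, algebraMap_smul] at hx ⊢
    rw [mem_functionalKer, smul_comm, hsoc.1, l.map_smul, smul_eq_mul, mul_eq_zero] at hx
    rw [hx.resolve_right hlv, zero_smul]
  let X := FGModuleCat.of R (hb.functionalKer v l hl0)
  let Y := FGModuleCat.of R (Submodule.span R {b (.inl v) • n})
  let e : N ≃ₗ[R] (X × Y) := (Submodule.prodEquivOfIsCompl _ _ hcompl).symm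
  obtain ⟨f⟩ := hb.simple_equiv_span hsoc hv
  have hY : Nontrivial Y := ⟨⟨⟨_, Submodule.mem_span_singleton_self _⟩, 0,
    fun h => hv (congrArg Subtype.val h)⟩⟩
  rw [cls_prod e, ← cls_congr (M := hb.simple v) (N := Y) f, ← hb.semisimpleCls_single]
  exact add_mem (ih _ (hl ▸ length_lt_of_equiv_prod e) X
    (fun α x => Subtype.ext (hN α _)) rfl) ⟨_, rfl⟩

theorem syzygyMap_mem_range (hb : IsRadSqZeroBasis b s t) (x : K0 R) :
    syzygyMap R x ∈ hb.semisimpleCls.range := by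
  refine K0_induction (H := hb.semisimpleCls.range.comap (syzygyMap R)) (fun M => ?_) x
  rw [AddSubgroup.mem_comap, syzygyMap_cls]
  obtain ⟨P, f, ⟨-, -, hf⟩, ⟨e⟩⟩ := isSyzygy_syzygy M
  refine hb.cls_mem_range_of_arrow_smul _ fun α n => e.injective ?_
  rw [map_smul, hb.arrow_smul_of_isSuperfluous hf, map_zero]

theorem cls_arrowSpan (hb : IsRadSqZeroBasis b s t) (F : Finset E) :
    cls (FGModuleCat.of R (hb.arrowSpan (F : Set E))) = ∑ α ∈ F, cls (hb.simple (t α)) := by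
  classical
  induction F using Finset.induction_on with
  | empty =>
    have : Subsingleton (FGModuleCat.of R (hb.arrowSpan ((∅ : Finset E) : Set E))) := by
      change Subsingleton (hb.arrowSpan ((∅ : Finset E) : Set E))
      simp only [arrowSpan, Finset.coe_empty, Set.image_empty, Submodule.span_empty]
      infer_instance
    rw [cls_subsingleton, Finset.sum_empty]
  | insert α F hα ih =>
    have hdis : Disjoint (hb.arrowSpan {α}) (hb.arrowSpan (F : Set E)) :=
      hb.disjoint_arrowSpan (by simpa using hα)
    have hsup : hb.arrowSpan ((insert α F : Finset E) : Set E) =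
        hb.arrowSpan {α} ⊔ hb.arrowSpan (F : Set E) := by
      simp only [arrowSpan]
      rw [← Submodule.span_union, ← Set.image_union, Finset.coe_insert, Set.insert_eq]
    obtain ⟨f⟩ := hb.simple_equiv_span (hb.arrow_mem_socle α) (b.ne_zero (.inr α))
    have hsing : hb.arrowSpan {α} = Submodule.span R {b (.inr α)} := by
      simp [arrowSpan]
    rw [Finset.sum_insert hα, ← ih, hsup, cls_sup_of_disjoint hdis, hsing]
    congr 1
    exact (cls_congr f).symm

/-- The radical of the projective module at `v` is the direct sum of the lines spanned by the arrows
out of `v`, each simple at its target. -/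
theorem syzygyMap_simple (hb : IsRadSqZeroBasis b s t) [DecidableEq V] (v : V) :
    syzygyMap R (cls (hb.simple v)) = ∑ α with s α = v, cls (hb.simple (t α)) := by
  have h : hb.arrowSpan {α | s α = v} ≤ hb.vertexProj v :=
    hb.arrowSpan_le_vertexProj fun α h => h
  rw [syzygyMap_cls, simple, hb.cls_syzygy_vertexQuot h, ← cls_arrowSpan, Finset.coe_filter_univ]

theorem syzygyMap_vertexQuot_arrow (hb : IsRadSqZeroBasis b s t) (α : E) :
    syzygyMap R (cls (hb.vertexQuot (s α) (hb.arrowSpan {α}))) = cls (hb.simple (t α)) := by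
  have := hb.cls_arrowSpan {α}
  rw [Finset.coe_singleton, Finset.sum_singleton] at this
  rw [syzygyMap_cls, hb.cls_syzygy_vertexQuot (hb.arrowSpan_le_vertexProj (by simp)), this]

/-- The second arrow `β` survives in the quotient and detects the coefficient at the top vertex. A
socle element therefore has none and lies in the radical. -/
theorem mult_vertexQuot_arrow (hb : IsRadSqZeroBasis b s t) {α β : E} (hne : β ≠ α)
    (hs : s β = s α) : hb.mult (hb.vertexQuot (s α) (hb.arrowSpan {α})) = 0 := by
  classical
  refine hb.mult_eq_zero fun w y hy => ?_
  obtain ⟨p, rfl⟩ := hb.vertexQuotMk_surjective _ _ y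
  have h1 : b (.inr β) * (p : R) ∈ hb.arrowSpan {α} := by
    have := hy.2 β
    rw [← map_smul, vertexQuotMk_eq_zero] at this
    exact this
  have h2 : b.repr (p : R) (.inl (s α)) = 0 := by
    have := hb.repr_arrowSpan h1 (i := .inr β) (by simpa using hne)
    simpa [hb.arrow_mul, hs] using this
  have h3 : ∀ u, b.repr (p : R) (.inl u) = 0 := by
    intro u
    rw [← hb.mul_vertex_of_mem p.2, hb.repr_mul_vertex]
    split_ifs with hu
    · rw [hu, h2]
    · rfl
  have h4 := hb.vertex_smul_mem_rad h3 w (hb.vertexQuotGen (s α) (hb.arrowSpan {α}))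
  rwa [smul_vertexQuotGen, hy.1] at h4

end IsRadSqZeroBasis

namespace IsRadSqZeroBasis

open IgusaTodorov Matrix

variable {K : Type z} [Field K] {R : Type u} [Ring R] [Algebra K R] {V : Type v} {E : Type w}
  [Fintype V] [Fintype E] {b : Module.Basis (V ⊕ E) K R} {s t : E → V}

/-! ### Self-injectivity -/

/-- The sum of the coefficients at the arrows is a Frobenius form if every vertex is the source of
some arrow and the target of at most one arrow. -/
theorem injective_self (hb : IsRadSqZeroBasis b s t) (hs : Function.Surjective s)
    (ht : Function.Injective t) : Module.Injective R R := by
  classical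
  have : Module.Finite K R := Module.Finite.of_basis b
  let form : R →ₗ[K] K := ∑ α, b.coord (.inr α)
  have hform : ∀ r, form r = ∑ α, b.repr r (.inr α) := fun r => by
    simp [form, LinearMap.sum_apply]
  -- Nondegeneracy: testing against an arrow out of `v` recovers the coefficient at `v`. Testing
  -- against the vertex `t α` then recovers the coefficient at `α`, since no other arrow ends there.
  have hnd : ∀ y, (∀ a, form (a * y) = 0) → y = 0 := by
    intro y hy
    have h1 : ∀ v, b.repr y (.inl v) = 0 := by
      intro v
      obtain ⟨α, rfl⟩ := hs v
      have := hy (b (.inr α))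
      rw [hb.arrow_mul, hform] at this
      simpa [Finsupp.single_apply] using this
    have h2 : ∀ α, b.repr y (.inr α) = 0 := by
      intro α
      have := hy (b (.inl (t α)))
      rw [hb.vertex_mul, hform] at this
      simpa [h1, ht.eq_iff, Finset.filter_eq', Finsupp.single_apply] using this
    rw [expand b y]
    simp [h1, h2]
  let pairing : R →ₗ[K] Module.Dual K R :=
    ((LinearMap.mul K R).flip).compr₂ form
  have hpair : ∀ y a, pairing y a = form (a * y) := fun y a => rfl
  have hinj : Function.Injective pairing := by
    rw [← LinearMap.ker_eq_bot, LinearMap.ker_eq_bot']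
    exact fun y hy => hnd y fun a => by rw [← hpair, hy, LinearMap.zero_apply]
  have hsurj : Function.Surjective pairing :=
    (LinearMap.injective_iff_surjective_of_finrank_eq_finrank
      (Subspace.dual_finrank_eq (K := K) (V := R)).symm).1 hinj
  refine Module.Baer.injective fun I g => ?_
  -- Baer's criterion through the form: extend `form ∘ g` to `R` over `K` and represent the
  -- extension as `a ↦ form (a * y)`. Right multiplication by `y` then extends `g`, by
  -- nondegeneracy.
  obtain ⟨h, hh⟩ := LinearMap.exists_extend (p := I.restrictScalars K)
    (form ∘ₗ (g.restrictScalars K : I.restrictScalars K →ₗ[K] R))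
  obtain ⟨y, hy⟩ := hsurj h
  refine ⟨LinearMap.toSpanSingleton R R y, fun x hx => ?_⟩
  rw [LinearMap.toSpanSingleton_apply, smul_eq_mul, eq_comm, ← sub_eq_zero]
  refine hnd _ fun a => ?_
  have h1 : form (a * (x * y)) = h (a * x) := by rw [← hy, hpair, mul_assoc]
  have h2 : h (a * x) = form (g ⟨a * x, I.smul_mem a hx⟩) :=
    LinearMap.congr_fun hh ⟨a * x, I.smul_mem a hx⟩
  have h3 : g ⟨a * x, I.smul_mem a hx⟩ = a * g ⟨x, hx⟩ := map_smul g a ⟨x, hx⟩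
  rw [mul_sub, map_sub, h1, h2, h3, sub_self]

/-- Otherwise `s` is bijective, so there are as many arrows as vertices. The surjection `t` is then
injective, and the Frobenius form makes `R` self-injective. -/
theorem exists_arrows_same_source (hb : IsRadSqZeroBasis b s t) (hs : Function.Surjective s)
    (ht : Function.Surjective t) (h : ¬ Module.Injective R R) : ∃ α β, β ≠ α ∧ s β = s α := by
  by_contra! hne
  have hsi : Function.Injective s := fun α β hαβ => by
    by_contra hn
    exact hne β α hn hαβ
  have hcard : Fintype.card E = Fintype.card V := Fintype.card_of_bijective ⟨hsi, hs⟩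
  exact h (hb.injective_self hs ((Fintype.bijective_iff_surjective_and_card t).2 ⟨ht, hcard⟩).1)

/-! ### The `φ`-dimension -/

variable [DecidableEq V]

/-- The matrix of the numbers of arrows between the vertices. -/
def arrowMatrix (s t : E → V) : Matrix V V ℤ :=
  Matrix.of fun a c => (Finset.card {α | s α = a ∧ t α = c} : ℤ)

variable [IsArtinianRing R]

theorem syzygyMap_semisimpleCls (hb : IsRadSqZeroBasis b s t) (x : V → ℤ) :
    syzygyMap R (hb.semisimpleCls x) = hb.semisimpleCls (x ᵥ* arrowMatrix s t) := by
  have h : ∀ v, syzygyMap R (cls (hb.simple v)) =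
      ∑ c, arrowMatrix s t v c • cls (hb.simple c) := by
    intro v
    rw [hb.syzygyMap_simple, ← Finset.sum_fiberwise_of_maps_to (g := t) (t := Finset.univ)
      (fun _ _ => Finset.mem_univ _)]
    refine Finset.sum_congr rfl fun c _ => ?_
    rw [Finset.filter_filter, Finset.sum_congr rfl (g := fun _ => cls (hb.simple c)) ?_,
      Finset.sum_const, arrowMatrix, Matrix.of_apply, natCast_zsmul]
    intro α hα
    rw [(Finset.mem_filter.1 hα).2.2]
  simp only [semisimpleCls_apply, map_sum, map_zsmul, h, vecMul, dotProduct, Finset.smul_sum,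
    Finset.sum_smul, mul_smul]
  exact Finset.sum_comm

theorem iterate_syzygyMap_semisimpleCls (hb : IsRadSqZeroBasis b s t) (n : ℕ) (x : V → ℤ) :
    (syzygyMap R)^[n] (hb.semisimpleCls x) = hb.semisimpleCls (x ᵥ* arrowMatrix s t ^ n) := by
  induction n with
  | zero => simp
  | succ n ih =>
    rw [Function.iterate_succ_apply', ih, syzygyMap_semisimpleCls, vecMul_vecMul, pow_succ]

theorem semisimpleCls_eq_zero (hb : IsRadSqZeroBasis b s t) (hs : Function.Surjective s)
    {x : V → ℤ} : hb.semisimpleCls x = 0 ↔ x = 0 := by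
  refine ⟨fun h => ?_, fun h => by rw [h, map_zero]⟩
  rw [← hb.multHom_semisimpleCls hs x, h, map_zero]

theorem exists_syzygyMap_eq (hb : IsRadSqZeroBasis b s t) (ht : Function.Surjective t)
    (x : V → ℤ) : ∃ y, syzygyMap R y = hb.semisimpleCls x := by
  choose g hg using ht
  refine ⟨∑ v, x v • cls (hb.vertexQuot (s (g v)) (hb.arrowSpan {g v})), ?_⟩
  simp only [map_sum, map_zsmul, syzygyMap_vertexQuot_arrow, hg, semisimpleCls_apply]

/-- If `0` is not an eigenvalue of the arrow matrix, then the class of a module with simple syzygy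
and without simple summands has a multiple with the syzygy of a semisimple class. -/
theorem exists_syzygyMap_eq_zero (hb : IsRadSqZeroBasis b s t) (hs : Function.Surjective s)
    (ht : Function.Surjective t) (hinj : ¬ Module.Injective R R)
    (h : ∀ x, x ᵥ* arrowMatrix s t = 0 → x = 0) : ∃ y : K0 R, syzygyMap R y = 0 ∧ y ≠ 0 := by
  obtain ⟨α, β, hne, hαβ⟩ := hb.exists_arrows_same_source hs ht hinj
  set M := arrowMatrix s t
  have hdet : M.det ≠ 0 := fun h0 => by
    obtain ⟨x, hx, hx'⟩ := Matrix.exists_vecMul_eq_zero_iff.2 h0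
    exact hx (h x hx')
  set c := cls (hb.vertexQuot (s α) (hb.arrowSpan {α})) with hc
  have hcm : hb.multHom hs c = 0 := by rw [hc, multHom_cls, hb.mult_vertexQuot_arrow hne hαβ]
  -- The adjugate solves `x M = det M · e` over `ℤ`, where `e` is the basis vector at `t α`; no
  -- division is needed.
  set x : V → ℤ := Pi.single (t α) 1 ᵥ* M.adjugate with hx
  have hxM : x ᵥ* M = M.det • Pi.single (t α) 1 := by
    rw [hx, vecMul_vecMul, adjugate_mul, vecMul_smul, vecMul_one]
  refine ⟨M.det • c - hb.semisimpleCls x, ?_, fun h0 => ?_⟩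
  · rw [map_sub, map_zsmul, hc, syzygyMap_vertexQuot_arrow, syzygyMap_semisimpleCls, hxM,
      map_zsmul, semisimpleCls_single, sub_self]
  -- `multHom` kills `c`, so vanishing would force `x = 0`, contrary to `x M = det M · e ≠ 0`.
  · have := congrArg (hb.multHom hs) h0
    rw [map_sub, map_zsmul, hcm, smul_zero, zero_sub, map_zero, neg_eq_zero,
      multHom_semisimpleCls] at this
    rw [this, zero_vecMul] at hxM
    have := congrFun hxM (t α)
    simp [hdet.symm] at this

theorem phiDim_eq (hb : IsRadSqZeroBasis b s t) (hs : Function.Surjective s)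
    (ht : Function.Surjective t) (hinj : ¬ Module.Injective R R) {m : ℕ}
    (h : ∀ x : V → ℤ, x ᵥ* arrowMatrix s t ^ (m + 1) = 0 → x ᵥ* arrowMatrix s t ^ m = 0)
    (h' : ∀ k, m = k + 1 → ∃ x : V → ℤ, x ᵥ* arrowMatrix s t ^ (k + 1) = 0 ∧
      x ᵥ* arrowMatrix s t ^ k ≠ 0) : phiDim R = ((m + 1 : ℕ) : ℕ∞) := by
  refine le_antisymm (phiDim_le fun n x hn hx => ?_) ?_
  -- One step is spent on reaching the semisimple classes, leaving `i + m` for the matrix. The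
  -- stability hypothesis is applied to the vector already multiplied by the `i`-th power.
  · obtain ⟨i, rfl⟩ : ∃ i, n = i + m + 1 := ⟨n - (m + 1), by omega⟩
    obtain ⟨y, hy⟩ := hb.syzygyMap_mem_range x
    rw [Function.iterate_succ_apply, ← hy, iterate_syzygyMap_semisimpleCls,
      hb.semisimpleCls_eq_zero hs] at hx ⊢
    rw [add_assoc, pow_add, ← vecMul_vecMul] at hx
    rw [pow_add, ← vecMul_vecMul]
    exact h _ hx
  · match m with
    | 0 =>
      obtain ⟨y, hy, hy0⟩ := hb.exists_syzygyMap_eq_zero hs ht hinj (by simpa using h)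
      exact le_phiDim (k := 0) (x := y) hy hy0
    | k + 1 =>
      obtain ⟨x, hx, hx'⟩ := h' k rfl
      obtain ⟨y, hy⟩ := hb.exists_syzygyMap_eq ht x
      refine le_phiDim (x := y) ?_ ?_ <;>
        rw [Function.iterate_succ_apply, hy, iterate_syzygyMap_semisimpleCls]
      · rw [hx, map_zero]
      · rwa [Ne, hb.semisimpleCls_eq_zero hs]

end IsRadSqZeroBasis

/-! ### A basis of `K Q / J²` -/

namespace PathAlg

variable (K : Type z) {V : Type v} [Field K] [Quiver.{w} V]

variable (V) in
/-- The type of all arrows of a quiver. -/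
abbrev Arrow : Type (max v w) := Σ a c : V, a ⟶ c

variable (V) in
/-- The span of the paths of length at least `k`. -/
def longPaths (k : ℕ) : Submodule K (PathAlgebra K V) :=
  Submodule.span K {x | ∃ (a c : V) (p : Quiver.Path a c), k ≤ p.length ∧ x = ofPath K p}

variable {K} in
theorem ofPath_mem_longPaths {k : ℕ} {a c : V} {p : Quiver.Path a c} (h : k ≤ p.length) :
    ofPath K p ∈ longPaths K V k := Submodule.subset_span ⟨a, c, p, h, rfl⟩

theorem longPaths_zero : longPaths K V 0 = ⊤ := by
  refine eq_top_iff.2 fun x _ => ?_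
  have h : ∀ x : QPath V →₀ K, (x : PathAlgebra K V) ∈ longPaths K V 0 := by
    intro x
    induction x using Finsupp.induction_linear with
    | zero => exact zero_mem _
    | add f g hf hg => exact add_mem hf hg
    | single p c =>
      have h1 : (Finsupp.single p c : QPath V →₀ K) = c • Finsupp.single p 1 := by simp
      rw [h1]
      exact Submodule.smul_mem (longPaths K V 0) c
        (ofPath_mem_longPaths (p := p.2.2) (Nat.zero_le _))
  exact h x

/-- The coefficients at the paths of length at most one. -/
def shortCoeff : PathAlgebra K V →ₗ[K] (V ⊕ Arrow V →₀ K) :=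
  lift fun p => match p with
    | ⟨a, _, .nil⟩ => Finsupp.single (.inl a) 1
    | ⟨a, c, .cons .nil α⟩ => Finsupp.single (.inr ⟨a, c, α⟩) 1
    | ⟨_, _, .cons (.cons _ _) _⟩ => 0

/-- With `mem_longPaths_of_mem_arrowIdeal_sq` this makes the short coefficients well defined modulo
`J²`, whence the linear independence of vertices and arrows. -/
theorem longPaths_two_le_ker : longPaths K V 2 ≤ LinearMap.ker (shortCoeff K (V := V)) := by
  rw [longPaths, Submodule.span_le]
  rintro _ ⟨a, c, p, hp, rfl⟩
  rw [SetLike.mem_coe, LinearMap.mem_ker, shortCoeff, lift_ofPath]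
  match p, hp with
  | .cons (.cons _ _) _, _ => rfl

variable [Fintype V]

theorem ofPath_mul_comp {a c d : V} (p : Quiver.Path a c) (q : Quiver.Path c d) :
    ofPath K p * ofPath K q = ofPath K (p.comp q) := mulHom_comp K p q

theorem ofPath_mul_ne {a c d e : V} (p : Quiver.Path a c) (q : Quiver.Path d e) (h : c ≠ d) :
    ofPath K p * ofPath K q = 0 := mulHom_ne K p q h

variable {K}

theorem mul_mem_longPaths {i j : ℕ} {x y : PathAlgebra K V} (hx : x ∈ longPaths K V i)
    (hy : y ∈ longPaths K V j) : x * y ∈ longPaths K V (i + j) := by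
  have h : longPaths K V i * longPaths K V j ≤ longPaths K V (i + j) := by
    rw [longPaths, longPaths, Submodule.span_mul_span, Submodule.span_le]
    rintro _ ⟨_, ⟨a, c, p, hp, rfl⟩, _, ⟨d, e, q, hq, rfl⟩, rfl⟩
    simp only
    by_cases hcd : c = d
    · subst hcd
      rw [ofPath_mul_comp]
      exact ofPath_mem_longPaths (by rw [Quiver.Path.length_comp]; omega)
    · rw [ofPath_mul_ne _ _ _ hcd]
      exact zero_mem _
  exact h (Submodule.mul_mem_mul hx hy)

theorem mem_longPaths_of_mem_arrowIdeal {x : PathAlgebra K V} (hx : x ∈ arrowIdeal K V) :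
    x ∈ longPaths K V 1 := by
  have htop : ∀ x, x ∈ longPaths K V 0 := fun x => by rw [longPaths_zero]; exact Submodule.mem_top
  -- Closed under multiplication on both sides because lengths add and every element lies in
  -- `longPaths K V 0`.
  let I : TwoSidedIdeal (PathAlgebra K V) := TwoSidedIdeal.mk' (longPaths K V 1 : Set _)
    (zero_mem _) (fun h h' => add_mem h h') (fun h => neg_mem h)
    (fun {x y} h => by simpa using mul_mem_longPaths (htop x) h)
    (fun {x y} h => by simpa using mul_mem_longPaths h (htop y))
  have hI : TwoSidedIdeal.span {x : PathAlgebra K V |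
      ∃ (a c : V) (α : a ⟶ c), x = ofPath K α.toPath} ≤ I := by
    rw [TwoSidedIdeal.span_le]
    rintro _ ⟨a, c, α, rfl⟩
    exact (TwoSidedIdeal.mem_mk' _ _ _ _ _ _ _).2 (ofPath_mem_longPaths le_rfl)
  exact (TwoSidedIdeal.mem_mk' _ _ _ _ _ _ _).1 (hI (TwoSidedIdeal.mem_asIdeal.1 hx))

variable (K V) in
theorem arrowIdeal_sq : arrowIdeal K V ^ 2 = arrowIdeal K V * arrowIdeal K V := by
  rw [Submodule.pow_succ, Submodule.pow_one]

theorem mem_longPaths_of_mem_arrowIdeal_sq {x : PathAlgebra K V} (hx : x ∈ arrowIdeal K V ^ 2) :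
    x ∈ longPaths K V 2 := by
  rw [arrowIdeal_sq] at hx
  exact Submodule.mul_induction_on (M := arrowIdeal K V) (N := arrowIdeal K V)
    (C := fun x => x ∈ longPaths K V 2) hx
    (fun x hx y hy => mul_mem_longPaths (i := 1) (j := 1) (mem_longPaths_of_mem_arrowIdeal hx)
      (mem_longPaths_of_mem_arrowIdeal hy))
    fun x y hx hy => (longPaths K V 2).add_mem hx hy

theorem arrow_mem_arrowIdeal {a c : V} (α : a ⟶ c) : ofPath K α.toPath ∈ arrowIdeal K V :=
  TwoSidedIdeal.mem_asIdeal.2 (TwoSidedIdeal.subset_span ⟨a, c, α, rfl⟩)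

theorem ofPath_mem_arrowIdeal_sq {a c : V} {p : Quiver.Path a c} (hp : 2 ≤ p.length) :
    ofPath K p ∈ arrowIdeal K V ^ 2 := by
  match p, hp with
  | .cons (.cons p α) β, _ =>
    have h : ofPath K ((p.cons α).cons β) =
        ofPath K p * ofPath K α.toPath * ofPath K β.toPath := by
      rw [ofPath_mul_comp, ofPath_mul_comp]
      rfl
    rw [h, arrowIdeal_sq]
    exact Ideal.mul_mem_mul (Ideal.mul_mem_left _ _ (arrow_mem_arrowIdeal α))
      (arrow_mem_arrowIdeal β)

variable (K) in
/-- The paths of length at most one in the path algebra. -/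
def shortPath : V ⊕ Arrow V → PathAlgebra K V
  | .inl v => ofPath K (Quiver.Path.nil : Quiver.Path v v)
  | .inr α => ofPath K α.2.2.toPath

theorem shortCoeff_shortPath (i : V ⊕ Arrow V) :
    shortCoeff K (shortPath K i) = Finsupp.single i 1 := by
  match i with
  | .inl v => rw [shortCoeff, shortPath, lift_ofPath]
  | .inr α => rw [shortCoeff, shortPath, lift_ofPath]; rfl

variable (K V) in
/-- The basis of `K Q / J²` given by the vertices and the arrows. -/
def quotBasis : Module.Basis (V ⊕ Arrow V) K (RadSqZero K V) :=
  Module.Basis.mk (v := fun i => Ideal.Quotient.mk (arrowIdeal K V ^ 2) (shortPath K i))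
    (by
      rw [linearIndependent_iff]
      intro l hl
      have h1 : Finsupp.linearCombination K (shortPath K) l ∈ arrowIdeal K V ^ 2 := by
        rw [← Ideal.Quotient.eq_zero_iff_mem, ← hl]
        exact (Finsupp.apply_linearCombination K
          (Ideal.Quotient.mkₐ K (arrowIdeal K V ^ 2)).toLinearMap (shortPath K) l)
      have h2 := longPaths_two_le_ker K (mem_longPaths_of_mem_arrowIdeal_sq h1)
      rw [LinearMap.mem_ker, Finsupp.apply_linearCombination] at h2
      have h3 : shortCoeff K ∘ shortPath K = fun i : V ⊕ Arrow V => Finsupp.single i 1 :=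
        funext shortCoeff_shortPath
      rw [h3] at h2
      rw [← h2, Finsupp.linearCombination_apply]
      simp)
    (by
      rintro x -
      obtain ⟨x, rfl⟩ := Ideal.Quotient.mk_surjective x
      have hx : x ∈ longPaths K V 0 := by rw [longPaths_zero]; exact Submodule.mem_top
      refine Submodule.span_induction (p := fun x _ => Ideal.Quotient.mk (arrowIdeal K V ^ 2) x ∈
        Submodule.span K (Set.range fun i => Ideal.Quotient.mk (arrowIdeal K V ^ 2)
          (shortPath K i))) ?_ ?_ ?_ ?_ hx
      · rintro _ ⟨a, c, p, -, rfl⟩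
        match p with
        | .nil => exact Submodule.subset_span ⟨.inl a, rfl⟩
        | .cons .nil α => exact Submodule.subset_span ⟨.inr ⟨a, _, α⟩, rfl⟩
        | .cons (.cons p α) β =>
          rw [Ideal.Quotient.eq_zero_iff_mem.2 (ofPath_mem_arrowIdeal_sq (by simp))]
          exact zero_mem _
      · rw [map_zero]
        exact zero_mem _
      · intro x y _ _ hx hy
        rw [map_add]
        exact add_mem hx hy
      · intro c x _ hx
        exact Submodule.smul_mem _ c hx)

theorem quotBasis_apply (i : V ⊕ Arrow V) :
    quotBasis K V i = Ideal.Quotient.mk (arrowIdeal K V ^ 2) (shortPath K i) := by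
  simp [quotBasis]

/-- The vertices and the arrows in the opposite of an algebra isomorphic to `K Q / J²`. -/
def opBasis {A : Type u} [Ring A] [Algebra K A] (e : A ≃ₐ[K] RadSqZero K V) :
    Module.Basis (V ⊕ Arrow V) K Aᵐᵒᵖ :=
  (quotBasis K V).map (e.symm.toLinearEquiv.trans (MulOpposite.opLinearEquiv K))

theorem opBasis_mul {A : Type u} [Ring A] [Algebra K A] (e : A ≃ₐ[K] RadSqZero K V)
    (i j : V ⊕ Arrow V) : opBasis e i * opBasis e j =
      MulOpposite.op (e.symm (Ideal.Quotient.mk (arrowIdeal K V ^ 2)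
        (shortPath K j * shortPath K i))) := by
  simp [opBasis, quotBasis_apply]

theorem opBasis_apply {A : Type u} [Ring A] [Algebra K A] (e : A ≃ₐ[K] RadSqZero K V)
    (i : V ⊕ Arrow V) : opBasis e i = MulOpposite.op (e.symm (Ideal.Quotient.mk
      (arrowIdeal K V ^ 2) (shortPath K i))) := by
  simp [opBasis, quotBasis_apply]

/-- Paths are multiplied in the order of travel; passing to the opposite ring turns this into the
order of composition of functions. -/
theorem isRadSqZeroBasis_opBasis {A : Type u} [Ring A] [Algebra K A]
    (e : A ≃ₐ[K] RadSqZero K V) : IsRadSqZeroBasis (opBasis e) (fun α => α.1) (fun α => α.2.1) where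
  vertex_mul_self v := by
    rw [opBasis_mul, opBasis_apply, shortPath, ofPath_mul_comp, Quiver.Path.nil_comp]
  vertex_mul_vertex x y h := by
    rw [opBasis_mul, shortPath, shortPath, ofPath_mul_ne _ _ _ h.symm]
    simp
  arrow_mul_source α := by
    rw [opBasis_mul, opBasis_apply, shortPath, shortPath, ofPath_mul_comp, Quiver.Path.nil_comp]
  target_mul_arrow α := by
    rw [opBasis_mul, opBasis_apply, shortPath, shortPath, ofPath_mul_comp, Quiver.Path.comp_nil]
  arrow_mul_arrow α β := by
    rw [opBasis_mul, Ideal.Quotient.eq_zero_iff_mem.2, map_zero, MulOpposite.op_zero]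
    rw [arrowIdeal_sq]
    exact Ideal.mul_mem_mul (arrow_mem_arrowIdeal _) (arrow_mem_arrowIdeal _)
  sum_vertex := by
    simp only [opBasis_apply]
    rw [← MulOpposite.op_one, ← map_one e.symm, ← map_one (Ideal.Quotient.mk (arrowIdeal K V ^ 2)),
      ← Finset.op_sum, ← map_sum, ← map_sum]
    rfl

end PathAlg

/-! ### Quivers without member -/

namespace QuiverHeart

open IgusaTodorov PathAlg

variable {K : Type z} {V : Type v} [Field K] [Quiver.{w} V] [Fintype V]
  [∀ a c : V, Fintype (a ⟶ c)]

theorem op_vertexIdem (v : V) : MulOpposite.op (vertexIdem K v) =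
    opBasis (AlgEquiv.refl : RadSqZero K V ≃ₐ[K] RadSqZero K V) (.inl v) := by
  rw [opBasis_apply]
  rfl

variable [Nonempty V]

theorem NoMember.exists_target (h : NoMember K V) (v : V) : ∃ α : Arrow V, α.2.1 = v := by
  obtain ⟨⟨N, hN, x, hx⟩, -⟩ := h v
  -- The number of vertices is positive, so the iterated syzygy is the syzygy of some module; only
  -- this last step matters.
  obtain ⟨n, hn⟩ := Nat.exists_eq_succ_of_ne_zero (Fintype.card_ne_zero (α := V))
  rw [hn] at hN
  obtain ⟨L, -, P, f, ⟨-, -, hf⟩, ⟨e⟩⟩ := hN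
  refine (isRadSqZeroBasis_opBasis
    (AlgEquiv.refl : RadSqZero K V ≃ₐ[K] RadSqZero K V)).exists_target_of_isSuperfluous hf
      (e x).2 fun h0 => hx (e.injective (Subtype.ext ?_))
  rw [map_smul, map_zero, op_vertexIdem]
  exact h0

theorem NoMember.exists_source (h : NoMember K V) (v : V) : ∃ α : Arrow V, α.1 = v := by
  obtain ⟨-, N, hN, x, hx⟩ := h v
  obtain ⟨n, hn⟩ := Nat.exists_eq_succ_of_ne_zero (Fintype.card_ne_zero (α := V))
  rw [hn] at hN
  obtain ⟨L, -, I, f, ⟨-, -, hf⟩, ⟨e⟩⟩ := hN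
  obtain ⟨y, hy⟩ := Submodule.mkQ_surjective _ (e x)
  refine (isRadSqZeroBasis_opBasis
    (AlgEquiv.refl : RadSqZero K V ≃ₐ[K] RadSqZero K V)).exists_source_of_isEssential hf
      (n := y) fun h0 => hx (e.injective ?_)
  rw [map_smul, map_zero, op_vertexIdem, ← hy, ← map_smul]
  exact (Submodule.Quotient.mk_eq_zero _).2 h0

end QuiverHeart

/-! ### Jordan forms and kernels of powers -/

open Matrix

/-- With the ones below the diagonal, a nilpotent block shifts row vectors towards smaller indices.
-/
theorem vecMul_jordanBlock_zero_pow {k : ℕ} (y : Fin k → ℂ) (n : ℕ) (i : Fin k) :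
    (y ᵥ* jordanBlock k 0 ^ n) i = if h : i + n < k then y ⟨i + n, h⟩ else 0 := by
  induction n generalizing i with
  | zero => simp
  | succ n ih =>
    rw [pow_succ, ← vecMul_vecMul, vecMul, dotProduct]
    simp only [ih]
    by_cases hi : (i : ℕ) + 1 < k
    · rw [Finset.sum_eq_single ⟨i + 1, hi⟩]
      · simp [jordanBlock, add_assoc, add_comm 1 n, Fin.ext_iff]
      · intro j _ hj
        have : (j : ℕ) ≠ i + 1 := fun h => hj (Fin.ext h)
        simp [jordanBlock, this]
      · simp
    · rw [dif_neg (by omega), Finset.sum_eq_zero]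
      intro j _
      have : (j : ℕ) ≠ i + 1 := by omega
      simp [jordanBlock, this]

theorem vecMul_jordanBlock_zero_pow_self {k n : ℕ} (h : k ≤ n) (y : Fin k → ℂ) :
    y ᵥ* jordanBlock k 0 ^ n = 0 := by
  ext i
  rw [vecMul_jordanBlock_zero_pow, dif_neg (by omega), Pi.zero_apply]

theorem det_jordanBlock (k : ℕ) (a : ℂ) : (jordanBlock k a).det = a ^ k := by
  rw [Matrix.det_of_isLowerTriangular]
  · simp [jordanBlock]
  · intro i j hij
    have hij' : (i : ℕ) < j := hij
    rw [jordanBlock, Matrix.of_apply, if_neg (Fin.ne_of_val_ne hij'.ne), if_neg (by omega)]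

/-- The kernels of the powers of a block diagonal matrix. -/
theorem vecMul_blockDiagonal'_pow {r : ℕ} (size : Fin r → ℕ)
    (B : ∀ i, Matrix (Fin (size i)) (Fin (size i)) ℂ)
    (y : (Σ i, Fin (size i)) → ℂ) (n : ℕ) (i : Fin r) (j : Fin (size i)) :
    (y ᵥ* blockDiagonal' B ^ n) ⟨i, j⟩ = ((fun j => y ⟨i, j⟩) ᵥ* B i ^ n) j := by
  rw [← blockDiagonal'_pow, vecMul, vecMul, dotProduct, dotProduct, Fintype.sum_sigma,
    Finset.sum_eq_single i]
  · simp
  · intro k _ hk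
    exact Finset.sum_eq_zero fun x _ => by rw [blockDiagonal'_apply_ne _ _ _ hk, mul_zero]
  · simp

/-- Blocks with nonzero eigenvalue are invertible; nilpotent ones of size at most `m` already vanish
at the power `m`. -/
theorem vecMul_jordanBlock_pow_of_succ {k m : ℕ} {a : ℂ} (h : a = 0 → k ≤ m) {y : Fin k → ℂ}
    (hy : y ᵥ* jordanBlock k a ^ (m + 1) = 0) : y ᵥ* jordanBlock k a ^ m = 0 := by
  by_cases ha : a = 0
  · subst ha
    exact vecMul_jordanBlock_zero_pow_self (h rfl) y
  · have hu : IsUnit (jordanBlock k a) := by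
      rw [Matrix.isUnit_iff_isUnit_det, det_jordanBlock]
      exact (pow_ne_zero _ ha).isUnit
    rw [pow_succ, ← vecMul_vecMul] at hy
    exact (vecMul_injective_iff_isUnit.2 hu) (by simpa using hy)

section JordanForm

variable {V : Type v} [Fintype V] [DecidableEq V] {M : Matrix V V ℂ} {r : ℕ} {size : Fin r → ℕ}
  {eig : Fin r → ℂ}

/-- The kernels of the powers of `M` correspond to those of the powers of a Jordan form. -/
theorem IsJordanForm.exists_equiv (h : IsJordanForm M size eig) :
    ∃ f : (V → ℂ) ≃ ((Σ i, Fin (size i)) → ℂ), ∀ n x, x ᵥ* M ^ n = 0 ↔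
      f x ᵥ* blockDiagonal' (fun i => jordanBlock (size i) (eig i)) ^ n = 0 := by
  obtain ⟨-, σ, P, hP, hPM⟩ := h
  set D := blockDiagonal' (fun i => jordanBlock (size i) (eig i))
  obtain ⟨Q, hQP, hPQ⟩ : ∃ Q, Q * P = 1 ∧ P * Q = 1 := by
    obtain ⟨U, rfl⟩ := hP
    exact ⟨↑U⁻¹, U.inv_mul, U.mul_inv⟩
  have hpow : ∀ n, P * M ^ n = reindex σ σ (D ^ n) * P := by
    intro n
    induction n with
    | zero => simp
    | succ n ih =>
      rw [pow_succ, ← mul_assoc, ih, mul_assoc, hPM, ← mul_assoc, pow_succ]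
      simp [submatrix_mul_equiv]
  have hre : ∀ (n : ℕ) (x : V → ℂ), x ᵥ* reindex σ σ (D ^ n) = ((x ∘ σ) ᵥ* D ^ n) ∘ σ.symm := by
    intro n x
    rw [reindex_apply, submatrix_vecMul_equiv]
    simp
  refine ⟨⟨fun x => (x ᵥ* Q) ∘ σ, fun y => (y ∘ σ.symm) ᵥ* P, fun x => ?_, fun y => ?_⟩,
    fun n x => ?_⟩
  · simp [Function.comp_assoc, vecMul_vecMul, hQP]
  · simp [Function.comp_assoc, vecMul_vecMul, hPQ]
  · have h1 : x ᵥ* M ^ n = ((((x ᵥ* Q) ∘ σ) ᵥ* D ^ n) ∘ σ.symm) ᵥ* P := by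
      rw [← hre, vecMul_vecMul, ← hpow, vecMul_vecMul, ← mul_assoc, hQP, one_mul]
    have hPi : Function.Injective fun x : V → ℂ => x ᵥ* P :=
      vecMul_injective_iff_isUnit.2 hP
    rw [h1]
    constructor
    · intro h0
      have h2 := hPi (h0.trans (zero_vecMul P).symm)
      ext i
      simpa using congrFun h2 (σ i)
    · intro h0
      change ((((x ᵥ* Q) ∘ σ) ᵥ* D ^ n) ∘ σ.symm) ᵥ* P = 0
      have h2 : ((x ᵥ* Q) ∘ σ) ᵥ* D ^ n = 0 := h0
      rw [h2]
      exact zero_vecMul P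

theorem le_maxBlockSize {i : Fin r} {a : ℂ} (h : eig i = a) :
    size i ≤ maxBlockSize size eig a := by
  classical
  have := Finset.le_sup (f := fun i => if eig i = a then size i else 0) (Finset.mem_univ i)
  simpa [maxBlockSize, h] using this

theorem exists_size_eq_maxBlockSize {a : ℂ} {k : ℕ} (h : maxBlockSize size eig a = k + 1) :
    ∃ i, eig i = a ∧ size i = k + 1 := by
  classical
  have hlt : k < maxBlockSize size eig a := by omega
  rw [maxBlockSize, Finset.lt_sup_iff] at hlt
  obtain ⟨i, -, hi⟩ := hlt
  split_ifs at hi with ha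
  · exact ⟨i, ha, le_antisymm (h ▸ le_maxBlockSize ha) hi⟩
  · omega

theorem IsJordanForm.vecMul_pow_eq_zero (h : IsJordanForm M size eig) {x : V → ℂ}
    (hx : x ᵥ* M ^ (maxBlockSize size eig 0 + 1) = 0) :
    x ᵥ* M ^ maxBlockSize size eig 0 = 0 := by
  obtain ⟨f, hf⟩ := h.exists_equiv
  rw [hf] at hx ⊢
  ext ⟨i, j⟩
  rw [vecMul_blockDiagonal'_pow, vecMul_jordanBlock_pow_of_succ fun h => le_maxBlockSize h]
  · rfl
  · ext j
    rw [← vecMul_blockDiagonal'_pow size (fun i => jordanBlock (size i) (eig i)), hx]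
    rfl

theorem IsJordanForm.exists_vecMul_pow_ne_zero (h : IsJordanForm M size eig) {k : ℕ}
    (hk : maxBlockSize size eig 0 = k + 1) :
    ∃ x, x ᵥ* M ^ (k + 1) = 0 ∧ x ᵥ* M ^ k ≠ 0 := by
  obtain ⟨f, hf⟩ := h.exists_equiv
  obtain ⟨i, hi, hik⟩ := exists_size_eq_maxBlockSize hk
  -- The last basis vector of a largest nilpotent block: `k` shifts bring it to index `0`, and one
  -- more kills it.
  let l : Fin (size i) := ⟨k, by omega⟩
  refine ⟨f.symm (Pi.single ⟨i, l⟩ 1), ?_, ?_⟩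
  · rw [hf, Equiv.apply_symm_apply]
    ext ⟨i', j⟩
    rw [vecMul_blockDiagonal'_pow]
    by_cases hii : i' = i
    · subst hii
      rw [hi, vecMul_jordanBlock_zero_pow_self hik.le]
      rfl
    · have : (fun j => (Pi.single ⟨i, l⟩ 1 : (Σ i, Fin (size i)) → ℂ) ⟨i', j⟩) = 0 := by
        ext j
        simp [hii]
      rw [this, zero_vecMul]
      rfl
  · rw [Ne, hf, Equiv.apply_symm_apply]
    intro h0
    have := congrFun h0 ⟨i, ⟨0, by omega⟩⟩
    rw [vecMul_blockDiagonal'_pow, hi, vecMul_jordanBlock_zero_pow, dif_pos (by simp [hik])] at this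
    simp [l] at this

end JordanForm

/-! ### Integral vectors in kernels of integral matrices -/

section Integral

variable {V : Type v} [Fintype V]

theorem vecMul_map_intCast {k : Type*} [CommRing k] (x : V → ℤ) (N : Matrix V V ℤ) :
    (fun v => (x v : k)) ᵥ* N.map (Int.cast : ℤ → k) = fun v => ((x ᵥ* N) v : k) := by
  ext v
  simp [vecMul, dotProduct]

/-- Two integral linear systems with different complex solutions have different integral ones. -/
theorem exists_int_vecMul {N N' : Matrix V V ℤ} {x : V → ℂ}
    (h : x ᵥ* N.map (Int.cast : ℤ → ℂ) = 0) (h' : x ᵥ* N'.map (Int.cast : ℤ → ℂ) ≠ 0) :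
    ∃ y : V → ℤ, y ᵥ* N = 0 ∧ y ᵥ* N' ≠ 0 := by
  obtain ⟨v, hv⟩ := Function.ne_iff.1 h'
  -- A `ℚ`-linear functional on `ℂ` that is nonzero at a surviving coordinate. Applied entrywise it
  -- commutes with integral matrices, so it yields a rational vector with the same properties.
  obtain ⟨f, hf⟩ := Module.Projective.exists_dual_ne_zero ℚ (V := ℂ) hv
  have hfN : ∀ N : Matrix V V ℤ, ∀ v, ((f ∘ x) ᵥ* N.map (Int.cast : ℤ → ℚ)) v =
      f ((x ᵥ* N.map (Int.cast : ℤ → ℂ)) v) := by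
    intro N v
    simp only [vecMul, dotProduct, map_sum, Function.comp_apply, Matrix.map_apply]
    refine Finset.sum_congr rfl fun w _ => ?_
    rw [mul_comm, mul_comm (x w), ← zsmul_eq_mul, ← zsmul_eq_mul, map_zsmul]
  obtain ⟨d, hd⟩ := IsLocalization.exist_integer_multiples_of_finite (nonZeroDivisors ℤ) (f ∘ x)
  choose y hy using hd
  have hd0 : ((d : ℤ) : ℚ) ≠ 0 := by exact_mod_cast nonZeroDivisors.coe_ne_zero d
  have hyd : (fun v => (y v : ℚ)) = ((d : ℤ) : ℚ) • (f ∘ x) := by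
    ext v
    have := hy v
    simpa using this
  have hyN : ∀ N : Matrix V V ℤ, ∀ v, (((y ᵥ* N) v : ℤ) : ℚ) =
      ((d : ℤ) : ℚ) * f ((x ᵥ* N.map (Int.cast : ℤ → ℂ)) v) := by
    intro N v
    rw [← hfN, ← congrFun (vecMul_map_intCast (k := ℚ) y N) v, hyd, smul_vecMul]
    rfl
  refine ⟨y, ?_, fun h0 => ?_⟩
  · ext v
    have := hyN N v
    rw [h] at this
    simpa using this
  · have := hyN N' v
    rw [h0] at this
    simp only [Pi.zero_apply, Int.cast_zero] at this
    exact mul_ne_zero hd0 hf this.symm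

end Integral

theorem map_arrowMatrix {V : Type v} [Quiver.{w} V] [Fintype V] [DecidableEq V]
    [∀ a b : V, Fintype (a ⟶ b)] :
    (IsRadSqZeroBasis.arrowMatrix (fun α : PathAlg.Arrow V => α.1) (fun α => α.2.1)).map
      (Int.cast : ℤ → ℂ) = adjacencyMatrix V := by
  ext a c
  rw [Matrix.map_apply, IsRadSqZeroBasis.arrowMatrix, adjacencyMatrix, Matrix.of_apply,
    Matrix.of_apply, Int.cast_natCast, Nat.cast_inj, ← Fintype.card_subtype]
  refine Fintype.card_congr
    { toFun := fun α => ((Quiver.homOfEq α.1.2.2 α.2.1 α.2.2))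
      invFun := fun α => ⟨⟨a, c, α⟩, rfl, rfl⟩
      left_inv := ?_
      right_inv := fun α => rfl }
  rintro ⟨⟨a, c, α⟩, rfl, rfl⟩
  rfl

/-- Self-injectivity is assumed to fail for `A` as a right module, whereas the general argument uses
the regular left module of the opposite ring. -/
theorem not_injective_mulOpposite {A : Type u} [Ring A] (h : ¬ Module.Injective Aᵐᵒᵖ A) :
    ¬ Module.Injective Aᵐᵒᵖ Aᵐᵒᵖ := by
  intro h'
  let e : A ≃ₗ[Aᵐᵒᵖ] Aᵐᵒᵖ :=
    { MulOpposite.opAddEquiv with map_smul' := fun _ _ => rfl }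
  exact h (Module.Baer.injective (Module.Baer.of_equiv e.symm (Module.Baer.of_injective h')))

end

theorem theorem4p22 {K : Type z} [Field K] {V : Type v} [Quiver.{w} V] [Fintype V] [DecidableEq V]
    [∀ a b : V, Fintype (a ⟶ b)] (hn : 2 ≤ Fintype.card V)
    {A : Type u} [Ring A] [Algebra K A] [IsArtinianRing Aᵐᵒᵖ]
    (hA : Nonempty (A ≃ₐ[K] RadSqZero K V))
    (hmember : QuiverHeart.NoMember K V)
    (hself : ¬ Module.Injective Aᵐᵒᵖ A)
    {r : ℕ} (size : Fin r → ℕ) (eig : Fin r → ℂ)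
    (hJ : IsJordanForm (adjacencyMatrix V) size eig) :
    IgusaTodorov.phiDim Aᵐᵒᵖ = ((maxBlockSize size eig 0 + 1 : ℕ) : ℕ∞) := by
  obtain ⟨e⟩ := hA
  have : Nonempty V := Fintype.card_pos_iff.1 (by omega)
  have hpow : ∀ n, (IsRadSqZeroBasis.arrowMatrix (fun α : PathAlg.Arrow V => α.1)
      (fun α => α.2.1) ^ n).map (Int.cast : ℤ → ℂ) = adjacencyMatrix V ^ n := fun n => by
    rw [← map_arrowMatrix]
    exact Matrix.map_pow _ (Int.castRingHom ℂ) n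
  refine (PathAlg.isRadSqZeroBasis_opBasis e).phiDim_eq hmember.exists_source
    hmember.exists_target (not_injective_mulOpposite hself) (fun x hx => ?_) fun k hk => ?_
  · by_contra hne
    have h : ∀ n, Matrix.vecMul (fun v => (x v : ℂ)) (adjacencyMatrix V ^ n) = 0 ↔
        Matrix.vecMul x (IsRadSqZeroBasis.arrowMatrix (fun α : PathAlg.Arrow V => α.1)
          (fun α => α.2.1) ^ n) = 0 := by
      intro n
      rw [← hpow, vecMul_map_intCast, funext_iff, funext_iff]
      simp
    exact hne ((h _).1 (hJ.vecMul_pow_eq_zero ((h _).2 hx)))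
  · obtain ⟨x, hx, hx'⟩ := hJ.exists_vecMul_pow_ne_zero hk
    rw [← hpow] at hx hx'
    exact exists_int_vecMul hx hx'
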